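/- Let $k,d\ge 1$ be integers and let $T$ be the infinite $(k+1)$-uniform $(d+1)$-regular hypertree, i.e. the hypergraph whose incidence graph (vertices versus hyperedges, joined by membership) is a tree, in which every hyperedge has $k+1$ vertices and every vertex lies in $d+1$ hyperedges. Let $G$ be a group of automorphisms of $T$ with finitely many orbits on vertices and on hyperedges; call these orbits the vertex-types and hyperedge-types, and write $T^G$ for $T$ labelled by these types. Let $D=[d_{ij}]$ and $K=[k_{ji}]$ be the branching matrices: every vertex of type $i$ is incident to exactly $d_{ij}$ hyperedges of type $j$, and every hyperedge of type $j$ contains exactly $k_{ji}$ vertices of type $i$. For a vertex $v$ of a hypergraph whose vertices and hyperedges are labelled by types, the $t$-neighbourhood $N_t(v)$ is the sub-hypergraph induced by the vertices at distance at most $t$ from $v$ (its hyperedges are those contained in this vertex set). A sequence $H_n$ of random finite hypergraphs, whose vertices and hyperedges are classified into the types of $T^G$ with every vertex-type present, converges locally to $T^G$ if for every $t\ge 0$ and every vertex-type $i$, $$\lim_{n\to\infty}\Pr\big[N_t(I_{n,i})\cong N_t(o_i)\big]=1,$$ where $I_{n,i}$ is a uniformly random vertex of type $i$ of $H_n$,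 $o_i$ is any vertex of type $i$ of $T^G$, the probability is over both $H_n$ and $I_{n,i}$, and $\cong$ denotes isomorphism preserving vertex-types, hyperedge-types and incidence. Then some sequence of random finite hypergraphs converges locally to $T^G$ if and only if the Markov chain $$P=\begin{bmatrix}0&\frac1{d+1}D\\[2pt] \frac1{k+1}K&0\end{bmatrix}$$ on the vertex-types and hyperedge-types is time-reversible, i.e. there is a probability distribution $\pi$ with $\pi_xP_{xy}=\pi_yP_{yx}$ for all $x,y$. Consequently, if $k\ge 2$ and $G=\widehat G$ is an extremal symmetry, that is, there are exactly two vertex-types and two hyperedge-types and, after naming the types, $D=\begin{bmatrix}1&d\\ d&1\end{bmatrix}$ and $K=\begin{bmatrix}k&1\\ 1&k\end{bmatrix}$, then no sequence of random finite hypergraphs converges locally to $T^{\widehat G}$. -/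

import Mathlib

open Filter Topology

noncomputable section

universe u v w

/-! ### Hypergraphs, distances, hypertrees, automorphisms -/

namespace Hypergraph

variable {V : Type u}

/-- The incidence graph: a bipartite graph with the vertices of `H` on one side and the hyperedges
of `H` on the other side, `x` being joined to `e` iff `x ∈ e`. -/
def incidenceGraph (H : Hypergraph V) : SimpleGraph (H.vertexSet ⊕ H.edgeSet) where
  Adj
    | .inl x, .inr e => x.1 ∈ e.1
    | .inr e, .inl x => x.1 ∈ e.1
    | _, _ => False
  symm := ⟨by rintro (x | e) (y | f) h <;> exact h⟩
  loopless := ⟨by rintro (x | e) h <;> exact h⟩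

/-- Two distinct vertices are joined iff some hyperedge contains both. -/
def primalGraph (H : Hypergraph V) : SimpleGraph V := SimpleGraph.fromRel H.Adj

/-- The vertices of `H` at distance at most `t` from `x`, the distance being the least number of
hyperedges on a path (infinite if there is no path). -/
def ball (H : Hypergraph V) (x : V) (t : ℕ) : Set V :=
  {y | y ∈ H.vertexSet ∧ H.primalGraph.edist x y ≤ t}

/-- `H` is a `(k+1)`-uniform `(d+1)`-regular hypertree. -/
structure IsRegularHypertree (H : Hypergraph V) (k d : ℕ) : Prop where
  isTree : H.incidenceGraph.IsTree
  uniform : ∀ e ∈ H.edgeSet, e.ncard = k + 1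
  regular : ∀ x ∈ H.vertexSet, {e | e ∈ H.edgeSet ∧ x ∈ e}.ncard = d + 1

/-- The automorphism group of `H`: permutations of the vertices together with the induced
permutations of the hyperedges. -/
def autGroup (H : Hypergraph V) :
    Subgroup (Equiv.Perm H.vertexSet × Equiv.Perm H.edgeSet) where
  carrier := {g | ∀ (x : H.vertexSet) (e : H.edgeSet), (g.1 x).1 ∈ (g.2 e).1 ↔ x.1 ∈ e.1}
  one_mem' := fun _ _ => Iff.rfl
  mul_mem' := fun {a b} ha hb x e => (ha (b.1 x) (b.2 e)).trans (hb x e)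
  inv_mem' := fun {a} ha x e => by simpa using (ha (a.1⁻¹ x) (a.2⁻¹ e)).symm

instance (H : Hypergraph V) : MulAction H.autGroup H.vertexSet where
  smul g x := g.1.1 x
  one_smul _ := rfl
  mul_smul _ _ _ := rfl

instance (H : Hypergraph V) : MulAction H.autGroup H.edgeSet where
  smul g e := g.1.2 e
  one_smul _ := rfl
  mul_smul _ _ _ := rfl

/-- The vertex-types: the orbits of `G` on the vertices. -/
abbrev VertexOrbit {H : Hypergraph V} (G : Subgroup H.autGroup) : Type u :=
  MulAction.orbitRel.Quotient G H.vertexSet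

/-- The hyperedge-types: the orbits of `G` on the hyperedges. -/
abbrev EdgeOrbit {H : Hypergraph V} (G : Subgroup H.autGroup) : Type u :=
  MulAction.orbitRel.Quotient G H.edgeSet

/-- The type of a vertex. -/
def vertexOrbit {H : Hypergraph V} (G : Subgroup H.autGroup) (x : H.vertexSet) : VertexOrbit G :=
  Quotient.mk _ x

/-- The type of a hyperedge. -/
def edgeOrbit {H : Hypergraph V} (G : Subgroup H.autGroup) (e : H.edgeSet) : EdgeOrbit G :=
  Quotient.mk _ e

theorem edgeOrbit_smul {H : Hypergraph V} (G : Subgroup H.autGroup) (g : G) (e : H.edgeSet) :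
    edgeOrbit G (g • e) = edgeOrbit G e :=
  Quotient.sound ⟨g, rfl⟩

theorem vertexOrbit_smul {H : Hypergraph V} (G : Subgroup H.autGroup) (g : G) (x : H.vertexSet) :
    vertexOrbit G (g • x) = vertexOrbit G x :=
  Quotient.sound ⟨g, rfl⟩

theorem smul_mem_smul_iff {H : Hypergraph V} (G : Subgroup H.autGroup) (g : G)
    (x : H.vertexSet) (e : H.edgeSet) : (g • x).1 ∈ (g • e).1 ↔ x.1 ∈ e.1 :=
  g.1.2 x e

theorem ncard_edges_smul {H : Hypergraph V} (G : Subgroup H.autGroup) (g : G)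
    (x : H.vertexSet) (j : EdgeOrbit G) :
    {e : H.edgeSet | (g • x).1 ∈ e.1 ∧ edgeOrbit G e = j}.ncard =
      {e : H.edgeSet | x.1 ∈ e.1 ∧ edgeOrbit G e = j}.ncard := by
  symm
  refine Set.ncard_congr (fun e _ => g • e) ?_ ?_ ?_
  · rintro e ⟨h1, h2⟩
    exact ⟨(smul_mem_smul_iff G g x e).2 h1, (edgeOrbit_smul G g e).trans h2⟩
  · intro a b _ _ h
    exact (MulAction.injective g) h
  · rintro e ⟨h1, h2⟩
    refine ⟨g⁻¹ • e, ⟨?_, (edgeOrbit_smul G g⁻¹ e).trans h2⟩, smul_inv_smul g e⟩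
    rw [← smul_mem_smul_iff G g, smul_inv_smul]
    exact h1

theorem ncard_vertices_smul {H : Hypergraph V} (G : Subgroup H.autGroup) (g : G)
    (e : H.edgeSet) (i : VertexOrbit G) :
    {x : H.vertexSet | x.1 ∈ (g • e).1 ∧ vertexOrbit G x = i}.ncard =
      {x : H.vertexSet | x.1 ∈ e.1 ∧ vertexOrbit G x = i}.ncard := by
  symm
  refine Set.ncard_congr (fun x _ => g • x) ?_ ?_ ?_
  · rintro x ⟨h1, h2⟩
    exact ⟨(smul_mem_smul_iff G g x e).2 h1, (vertexOrbit_smul G g x).trans h2⟩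
  · intro a b _ _ h
    exact (MulAction.injective g) h
  · rintro x ⟨h1, h2⟩
    refine ⟨g⁻¹ • x, ⟨?_, (vertexOrbit_smul G g⁻¹ x).trans h2⟩, smul_inv_smul g x⟩
    rw [← smul_mem_smul_iff G g, smul_inv_smul]
    exact h1

/-- The branching matrix `D`: the entry `d i j` is the number of hyperedges of type `j` that are
incident to a vertex of type `i` (any vertex of type `i` gives the same number). -/
def branchingD {H : Hypergraph V} (G : Subgroup H.autGroup) :
    Matrix (VertexOrbit G) (EdgeOrbit G) ℕ := fun i j =>
  Quotient.lift (fun x : H.vertexSet => {e : H.edgeSet | x.1 ∈ e.1 ∧ edgeOrbit G e = j}.ncard)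
    (by rintro _ x ⟨g, rfl⟩; exact ncard_edges_smul G g x j) i

/-- The branching matrix `K`: the entry `k j i` is the number of vertices of type `i` that are
contained in a hyperedge of type `j` (any hyperedge of type `j` gives the same number). -/
def branchingK {H : Hypergraph V} (G : Subgroup H.autGroup) :
    Matrix (EdgeOrbit G) (VertexOrbit G) ℕ := fun j i =>
  Quotient.lift (fun e : H.edgeSet => {x : H.vertexSet | x.1 ∈ e.1 ∧ vertexOrbit G x = i}.ncard)
    (by rintro _ e ⟨g, rfl⟩; exact ncard_vertices_smul G g e i) j

/-- The projected bipartite Markov chain with transition matrix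
`[[0, D / (d + 1)], [K / (k + 1), 0]]` on the vertex-types and hyperedge-types. -/
def projectedChain {H : Hypergraph V} (G : Subgroup H.autGroup) (k d : ℕ) :
    Matrix (VertexOrbit G ⊕ EdgeOrbit G) (VertexOrbit G ⊕ EdgeOrbit G) ℝ :=
  Matrix.fromBlocks
    0 (((d : ℝ) + 1)⁻¹ • (branchingD G).map (fun n : ℕ => (n : ℝ)))
    (((k : ℝ) + 1)⁻¹ • (branchingK G).map (fun n : ℕ => (n : ℝ))) 0

/-- `G` is an extremal symmetry: there are two vertex-types and two hyperedge-types, and after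
naming the types of each kind `0` and `1`, the branching matrices are
`D = [[1, d], [d, 1]]` and `K = [[k, 1], [1, k]]`. -/
def IsExtremalSymmetry {H : Hypergraph V} (G : Subgroup H.autGroup) (k d : ℕ) : Prop :=
  ∃ (a : VertexOrbit G ≃ Fin 2) (b : EdgeOrbit G ≃ Fin 2),
    branchingD G = (!![1, d; d, 1] : Matrix (Fin 2) (Fin 2) ℕ).submatrix a b ∧
    branchingK G = (!![k, 1; 1, k] : Matrix (Fin 2) (Fin 2) ℕ).submatrix b a

end Hypergraph

/-- A Markov chain on a finite state space with transition matrix `P` is time-reversible: some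
probability distribution satisfies the detailed balance equations. -/
def IsTimeReversible {S : Type u} [Fintype S] (P : Matrix S S ℝ) : Prop :=
  ∃ p : S → ℝ, (∀ x, 0 ≤ p x) ∧ ∑ x, p x = 1 ∧ ∀ x y, p x * P x y = p y * P y x

/-! ### Hypergraphs whose vertices and hyperedges carry types -/

/-- A hypergraph whose vertices are classified into types from `A` and whose hyperedges are
classified into types from `B`. -/
structure TypedHypergraph (A : Type u) (B : Type v) (V : Type w) extends Hypergraph V where
  /-- the type of a vertex -/
  vtype : vertexSet → A
  /-- the type of a hyperedge -/
  etype : edgeSet → B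

namespace TypedHypergraph

variable {A : Type u} {B : Type v} {V : Type w}

/-- The sub-hypergraph induced by the vertices in `S`: its hyperedges are those contained
in `S`. -/
def induce (H : TypedHypergraph A B V) (S : Set V) : TypedHypergraph A B V where
  vertexSet := {x | x ∈ H.vertexSet ∧ x ∈ S}
  edgeSet := {e | e ∈ H.edgeSet ∧ e ⊆ S}
  subset_vertexSet_of_mem_edgeSet' := fun _ he _ hx =>
    ⟨H.subset_vertexSet_of_mem_edgeSet' he.1 hx, he.2 hx⟩
  vtype x := H.vtype ⟨x.1, x.2.1⟩
  etype e := H.etype ⟨e.1, e.2.1⟩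

/-- The `t`-neighbourhood of `x`: the sub-hypergraph induced by the vertices at distance at most
`t` from `x`. -/
def nbhd (H : TypedHypergraph A B V) (x : V) (t : ℕ) : TypedHypergraph A B V :=
  H.induce (H.ball x t)

/-- Isomorphism preserving the vertex-types, the hyperedge-types and the incidence relation. -/
def Isomorphic {V : Type*} {V' : Type*} (H : TypedHypergraph A B V)
    (H' : TypedHypergraph A B V') : Prop :=
  ∃ (f : H.vertexSet ≃ H'.vertexSet) (g : H.edgeSet ≃ H'.edgeSet),
    (∀ x e, (f x).1 ∈ (g e).1 ↔ x.1 ∈ e.1) ∧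
    (∀ x, H'.vtype (f x) = H.vtype x) ∧ (∀ e, H'.etype (g e) = H.etype e)

end TypedHypergraph

/-- The hypergraph `H` labelled by the orbits of the group `G` of automorphisms. -/
def Hypergraph.labelled {V : Type u} (H : Hypergraph V) (G : Subgroup H.autGroup) :
    TypedHypergraph (Hypergraph.VertexOrbit G) (Hypergraph.EdgeOrbit G) V where
  toHypergraph := H
  vtype := Hypergraph.vertexOrbit G
  etype := Hypergraph.edgeOrbit G

/-- A finite hypergraph with types, with vertices taken from `ℕ`, in which there is a vertex of
each type (so that a uniformly random vertex of a given type makes sense). -/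
structure FiniteTypedHypergraph (A : Type u) (B : Type v) extends TypedHypergraph A B ℕ where
  finite_vertexSet : vertexSet.Finite
  vtype_surjective : Function.Surjective vtype

namespace FiniteTypedHypergraph

variable {A : Type u} {B : Type v}

/-- The vertices of type `i`. -/
def verticesOfType (H : FiniteTypedHypergraph A B) (i : A) : Finset H.vertexSet :=
  haveI : Finite H.vertexSet := H.finite_vertexSet
  (Set.toFinite {x : H.vertexSet | H.vtype x = i}).toFinset

theorem verticesOfType_nonempty (H : FiniteTypedHypergraph A B) (i : A) :
    (H.verticesOfType i).Nonempty := by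
  obtain ⟨x, hx⟩ := H.vtype_surjective i
  exact ⟨x, by simpa [verticesOfType] using hx⟩

/-- The joint law of `(H, I)`, where `H` is a random finite hypergraph with law `P` and `I` is a
uniformly random vertex of type `i` of `H`. -/
def jointLaw (P : PMF (FiniteTypedHypergraph A B)) (i : A) :
    PMF (Σ H : FiniteTypedHypergraph A B, H.vertexSet) :=
  P.bind fun H =>
    (PMF.uniformOfFinset (H.verticesOfType i) (H.verticesOfType_nonempty i)).map (Sigma.mk H)

/-- The random finite hypergraphs with laws `P n` converge locally to `T`: for every `t` and every
vertex-type `i`, the probability that the `t`-neighbourhood of a uniformly random vertex of type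
`i` is isomorphic to that of a vertex `o` of type `i` of `T` tends to `1`. -/
def ConvergesLocally {V : Type*} (P : ℕ → PMF (FiniteTypedHypergraph A B))
    (T : TypedHypergraph A B V) : Prop :=
  ∀ (t : ℕ) (i : A) (o : T.vertexSet), T.vtype o = i →
    Tendsto (fun n => (jointLaw (P n) i).toOuterMeasure
      {z | (z.1.nbhd z.2 t).Isomorphic (T.nbhd o t)}) atTop (𝓝 1)

end FiniteTypedHypergraph

end

/-! Dividing the two halves of `π` by `d + 1` and `k + 1` turns detailed balance into `n i * D i j =
m j * K j i`. In a finite hypergraph with the branching of `T`, these equations count incidences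
between vertices of type `i` and hyperedges of type `j` in two ways. Local convergence supplies such
hypergraphs approximately, and reversibility lets them be built exactly.

Convergence implies reversibility. `ConvergesLocally.exists_good` extracts one finite hypergraph in
which all but a proportion `ε` of the vertices of each type have the correct 2-neighbourhood. Double
counting around those vertices (`exists_edge_counts`) gives the balance equations up to relative
error `ε`, and compactness of the simplex (`exists_balanced_of_approx`) gives an exact solution.

Reversibility implies convergence. The incidence graph of `T` is connected and adjacent nodes have
positive branching numbers, so the ratios of the weights are positive rationals and the equations
have a solution in positive integers. These integers are the sizes of the fibres of a finite
bipartite multigraph with branching `D` and `K`. Lifting it along a finite group generated by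
involutions without short relations (`exists_involutions_no_short_relation`, `exists_finite_cover`)
gives finite hypergraphs of large girth. The tree `T` covers each of them, the covering is injective
on balls small compared with the girth, and so every neighbourhood of the given radius is correct.

For an extremal symmetry, following the four balance equations around the cycle of types multiplies
a weight by `(k * d) ^ 2 > 1`, so every weight vanishes. -/

namespace SimpleGraph

/-! ### Coverings of graphs by trees -/

variable {α : Type*} {β : Type*} {A : SimpleGraph α} {B : SimpleGraph β}

/-- Uniqueness of the parent in a rooted tree: geodesics from `o` extended through `p` and `q` are
both paths to `y`, hence equal, and `p`, `q` are their penultimate vertices. -/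
theorem IsTree.eq_of_adj_of_dist_eq_add_one (hA : A.IsTree) (o : α) {y p q : α}
    (hp : A.Adj y p) (hq : A.Adj y q) (dp : A.dist o y = A.dist o p + 1)
    (dq : A.dist o y = A.dist o q + 1) : p = q := by
  obtain ⟨wp, hwp⟩ := hA.1.exists_walk_length_eq_dist o p
  obtain ⟨wq, hwq⟩ := hA.1.exists_walk_length_eq_dist o q
  have h1 : (wp.concat hp.symm).IsPath := Walk.isPath_of_length_eq_dist _ (by simp [hwp, dp])
  have h2 : (wq.concat hq.symm).IsPath := Walk.isPath_of_length_eq_dist _ (by simp [hwq, dq])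
  have h := (hA.existsUnique_path o y).unique h1 h2
  simpa using congrArg Walk.penultimate h

theorem Connected.exists_adj_dist_eq_add_one (hA : A.Connected) (o : α) {y : α} (hy : y ≠ o) :
    ∃ p, A.Adj y p ∧ A.dist o y = A.dist o p + 1 := by
  obtain ⟨w, hw⟩ := hA.exists_walk_length_eq_dist y o
  cases w with
  | nil => exact absurd rfl hy
  | @cons _ p _ h w =>
    refine ⟨p, h, ?_⟩
    have h1 : A.dist o p ≤ w.length := by rw [dist_comm]; exact dist_le w
    have h2 : A.dist o y ≤ A.dist o p + A.dist p y := hA.dist_triangle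
    have h3 : A.dist p y ≤ 1 := by
      rw [dist_comm]; exact (dist_eq_one_iff_adj.2 h).le
    rw [Walk.length_cons, dist_comm] at hw
    omega

/-- At most one neighbour of a node is nearer to `c`, so with two neighbours available it is always
possible to step further away. -/
theorem IsTree.exists_dist_eq_add (hA : A.IsTree)
    (h2 : ∀ a, ∃ x y, x ≠ y ∧ A.Adj a x ∧ A.Adj a y) (c z : α) (n : ℕ) :
    ∃ y, A.dist c y = A.dist c z + n ∧ A.dist z y ≤ n := by
  induction n with
  | zero => exact ⟨z, rfl, by simp⟩
  | succ n ih =>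
    obtain ⟨y, hy, hz⟩ := ih
    have key : ∃ q, A.Adj y q ∧ A.dist c q = A.dist c y + 1 := by
      by_contra! hcon
      obtain ⟨x, x', hne, hx, hx'⟩ := h2 y
      refine hne (hA.eq_of_adj_of_dist_eq_add_one c hx hx' ?_ ?_)
      · exact (hA.dist_eq_dist_add_one_of_adj c hx).resolve_right (hcon x hx)
      · exact (hA.dist_eq_dist_add_one_of_adj c hx').resolve_right (hcon x' hx')
    obtain ⟨q, hq, hd⟩ := key
    refine ⟨q, by omega, ?_⟩
    have h3 : A.dist z q ≤ A.dist z y + A.dist y q := hA.1.dist_triangle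
    have h4 := dist_eq_one_iff_adj.2 hq
    omega

/-- A colour-preserving matching of two neighbourhoods with a prescribed value. -/
theorem exists_bijOn_neighbors {C : Type*} (cA : α → C) (cB : β → C) (a : α) (b : β)
    (h : ∀ c, Nonempty ({x // A.Adj a x ∧ cA x = c} ≃ {y // B.Adj b y ∧ cB y = c}))
    (a' : α) (b' : β) :
    ∃ σ : α → β, Set.BijOn σ {x | A.Adj a x} {y | B.Adj b y} ∧
      (∀ x, A.Adj a x → cB (σ x) = cA x) ∧
      (A.Adj a a' → B.Adj b b' → cA a' = cB b' → σ a' = b') := by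
  classical
  have e : ∀ c, {x : {x // A.Adj a x} // cA x = c} ≃ {y : {y // B.Adj b y} // cB y = c} := fun c =>
    (Equiv.subtypeSubtypeEquivSubtypeInter _ (fun x => cA x = c)).trans
      ((h c).some.trans (Equiv.subtypeSubtypeEquivSubtypeInter _ (fun y => cB y = c)).symm)
  let τ : {x // A.Adj a x} ≃ {y // B.Adj b y} :=
    Equiv.ofFiberEquiv (f := fun x : {x // A.Adj a x} => cA x)
      (g := fun y : {y // B.Adj b y} => cB y) e
  have hτ : ∀ x, cB (τ x) = cA x := fun x =>
    Equiv.ofFiberEquiv_map (f := fun x : {x // A.Adj a x} => cA x)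
      (g := fun y : {y // B.Adj b y} => cB y) e x
  obtain ⟨ρ, hρ, hρ'⟩ : ∃ ρ : {x // A.Adj a x} ≃ {y // B.Adj b y}, (∀ x, cB (ρ x) = cA x) ∧
      (∀ (h1 : A.Adj a a') (h2 : B.Adj b b'), cA a' = cB b' → ρ ⟨a', h1⟩ = ⟨b', h2⟩) := by
    by_cases hc : A.Adj a a' ∧ B.Adj b b' ∧ cA a' = cB b'
    · obtain ⟨h1, h2, h3⟩ := hc
      -- The swap forces the prescribed value; it exchanges two nodes of the same colour, so colours
      -- are kept.
      refine ⟨τ.trans (Equiv.swap (τ ⟨a', h1⟩) ⟨b', h2⟩), fun x => ?_, fun _ _ _ => by simp⟩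
      rw [Equiv.trans_apply, Equiv.swap_apply_def]
      split_ifs with h4 h5
      · rw [← hτ x, h4, hτ]; exact h3.symm
      · rw [hτ, ← hτ x, h5]; exact h3
      · exact hτ x
    · exact ⟨τ, hτ, fun h1 h2 h3 => absurd ⟨h1, h2, h3⟩ hc⟩
  refine ⟨fun x => if hx : A.Adj a x then (ρ ⟨x, hx⟩).1 else b, ⟨?_, ?_, ?_⟩, ?_, ?_⟩
  · intro x hx
    have hx' : A.Adj a x := hx
    simp [hx']
  · intro x hx y hy hxy
    have hx' : A.Adj a x := hx
    have hy' : A.Adj a y := hy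
    simp only [hx', hy', dif_pos] at hxy
    simpa using ρ.injective (Subtype.ext hxy)
  · intro y hy
    refine ⟨(ρ.symm ⟨y, hy⟩).1, (ρ.symm ⟨y, hy⟩).2, ?_⟩
    have := (ρ.symm ⟨y, hy⟩).2
    simp [this]
  · intro x hx
    simpa [hx] using hρ ⟨x, hx⟩
  · intro h1 h2 h3
    simp [h1, hρ' h1 h2 h3]

/-- Built by recursion on the distance from the root. At each node the neighbours are matched colour
by colour, with the parent sent to the image already chosen for it. -/
theorem IsTree.exists_covering {C : Type*} (hA : A.IsTree) (cA : α → C) (cB : β → C)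
    (h : ∀ a b, cA a = cB b → ∀ c,
      Nonempty ({x // A.Adj a x ∧ cA x = c} ≃ {y // B.Adj b y ∧ cB y = c}))
    (o : α) (b₀ : β) (h₀ : cA o = cB b₀) :
    ∃ Φ : α → β, Φ o = b₀ ∧ (∀ a, cB (Φ a) = cA a) ∧
      ∀ a, Set.BijOn Φ {x | A.Adj a x} {y | B.Adj (Φ a) y} := by
  classical
  have hσ : ∀ a b a' b', ∃ σ : α → β, cA a = cB b →
      (Set.BijOn σ {x | A.Adj a x} {y | B.Adj b y} ∧ (∀ x, A.Adj a x → cB (σ x) = cA x) ∧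
      (A.Adj a a' → B.Adj b b' → cA a' = cB b' → σ a' = b')) := by
    intro a b a' b'
    by_cases hab : cA a = cB b
    · obtain ⟨σ, hσ⟩ := exists_bijOn_neighbors cA cB a b (h a b hab) a' b'
      exact ⟨σ, fun _ => hσ⟩
    · exact ⟨fun _ => b, fun h' => absurd h' hab⟩
  choose σ hσ using hσ
  have hp : ∀ y, ∃ p, (y = o → p = o) ∧ (y ≠ o → A.Adj y p ∧ A.dist o y = A.dist o p + 1) := by
    intro y
    by_cases hy : y = o
    · exact ⟨o, fun _ => rfl, fun h' => absurd hy h'⟩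
    · obtain ⟨p, hp⟩ := hA.1.exists_adj_dist_eq_add_one o hy
      exact ⟨p, fun h' => absurd h' hy, fun _ => hp⟩
  choose p hpo hp using hp
  -- The pair holds the image of a node and the image of its parent. At the root the second entry is
  -- a dummy, harmless because the root is not adjacent to itself.
  let F : ℕ → α → β × β := fun n => Nat.rec (fun _ => (b₀, b₀))
    (fun _ f y => (σ (p y) (f (p y)).1 (p (p y)) (f (p y)).2 y, (f (p y)).1)) n
  let Ψ : α → β × β := fun y => F (A.dist o y) y
  have hΨo : Ψ o = (b₀, b₀) := by simp [Ψ, F]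
  have hΨ : ∀ y, y ≠ o →
      Ψ y = (σ (p y) (Ψ (p y)).1 (p (p y)) (Ψ (p y)).2 y, (Ψ (p y)).1) := by
    intro y hy
    simp only [Ψ]
    rw [(hp y hy).2]
  have hcol : ∀ n y, A.dist o y = n → cB (Ψ y).1 = cA y := by
    intro n
    induction n with
    | zero =>
      intro y hy
      have : y = o := (hA.1.dist_eq_zero_iff.1 hy).symm
      subst this
      rw [hΨo]; exact h₀.symm
    | succ n ih =>
      intro y hy
      have hyo : y ≠ o := by rintro rfl; simp at hy
      have h1 := hp y hyo
      rw [hΨ y hyo]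
      exact (hσ _ _ _ _ (ih (p y) (by omega)).symm).2.1 y h1.1.symm
  have hcol' : ∀ y, cB (Ψ y).1 = cA y := fun y => hcol _ y rfl
  have hnb : ∀ a x, A.Adj a x → (Ψ x).1 = σ a (Ψ a).1 (p a) (Ψ a).2 x := by
    intro a x hax
    -- Either `x` is the parent of `a`, where the prescribed value of the matching applies, or `a`
    -- is the parent of `x`, where the recursion does.
    rcases hA.dist_eq_dist_add_one_of_adj o hax with hd | hd
    · have hao : a ≠ o := by rintro rfl; simp at hd
      have hx : x = p a := hA.eq_of_adj_of_dist_eq_add_one o hax (hp a hao).1 hd (hp a hao).2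
      have h2 : (Ψ a).2 = (Ψ x).1 := by rw [hΨ a hao, hx]
      have hadj : B.Adj (Ψ x).1 (Ψ a).1 := by
        rw [hΨ a hao, ← hx]
        exact (hσ x _ _ _ (hcol' x).symm).1.mapsTo hax.symm
      rw [← hx, h2]
      exact ((hσ a (Ψ a).1 x (Ψ x).1 (hcol' a).symm).2.2 hax hadj.symm (hcol' x).symm).symm
    · have hxo : x ≠ o := by rintro rfl; simp at hd
      have ha : a = p x := hA.eq_of_adj_of_dist_eq_add_one o hax.symm (hp x hxo).1 hd (hp x hxo).2
      rw [hΨ x hxo, ← ha]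
  refine ⟨fun y => (Ψ y).1, by simp [hΨo], hcol', fun a => ?_⟩
  exact (hσ a (Ψ a).1 (p a) (Ψ a).2 (hcol' a).symm).1.congr fun x hx => (hnb a x hx).symm

/-- Every closed non-backtracking walk of `B` is longer than `r`. -/
def NoShortClosedWalk (B : SimpleGraph β) (r : ℕ) : Prop :=
  ∀ (w : ℕ → β) (n : ℕ), 0 < n → n ≤ r → (∀ l < n, B.Adj (w l) (w (l + 1))) →
    (∀ l, l + 1 < n → w l ≠ w (l + 2)) → w 0 ≠ w n

/-- Local injectivity makes the image of a geodesic non-backtracking, so a collision of its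
endpoints would be a short closed walk. -/
theorem IsTree.eq_of_covering_eq (hA : A.IsTree) {r : ℕ} (hB : B.NoShortClosedWalk r) {Φ : α → β}
    (hΦ : ∀ a, Set.BijOn Φ {x | A.Adj a x} {y | B.Adj (Φ a) y}) {a b : α}
    (hab : A.dist a b ≤ r) (h : Φ a = Φ b) : a = b := by
  by_contra hne
  obtain ⟨p, hp, hl⟩ := hA.1.exists_path_of_dist a b
  have hpos : 0 < p.length := by
    rw [hl]; exact hA.1.pos_dist_of_ne hne
  refine hB (fun l => Φ (p.getVert l)) p.length hpos (hl ▸ hab) ?_ ?_ (by simpa using h)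
  · intro l hl'
    exact (hΦ _).mapsTo (p.adj_getVert_succ hl')
  · intro l hl' heq
    have h1 := (p.adj_getVert_succ (i := l) (by omega)).symm
    have h2 := p.adj_getVert_succ (i := l + 1) (by omega)
    have h3 := (hΦ _).injOn h1 h2 heq
    have h4 := hp.getVert_injOn (by simp; omega) (by simp; omega) h3
    omega

end SimpleGraph

/-! ### Balls in a hypergraph and distances in its incidence graph -/

namespace Hypergraph

variable {V : Type u} {H : Hypergraph V}

theorem self_mem_ball {x : V} (hx : x ∈ H.vertexSet) (t : ℕ) : x ∈ H.ball x t :=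
  ⟨hx, by simp⟩

theorem edist_primalGraph_le_one {x y : V} (h : H.Adj x y) : H.primalGraph.edist x y ≤ 1 := by
  rw [SimpleGraph.edist_le_one_iff_adj_or_eq]
  by_cases hxy : x = y
  · exact Or.inr hxy
  · exact Or.inl ⟨hxy, Or.inl h⟩

theorem adj_of_primalGraph_adj {x y : V} (h : H.primalGraph.Adj x y) : H.Adj x y :=
  h.2.elim id fun h' => h'.symm

theorem mem_ball_zero {x y : V} (h : y ∈ H.ball x 0) : y = x := by
  have := h.2
  simp only [CharP.cast_eq_zero, nonpos_iff_eq_zero, SimpleGraph.edist_eq_zero_iff] at this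
  exact this.symm

theorem mem_ball_succ_of_adj {x y z : V} {t : ℕ} (hy : y ∈ H.ball x t) (h : H.Adj y z) :
    z ∈ H.ball x (t + 1) := by
  refine ⟨?_, ?_⟩
  · obtain ⟨e, he, -, hz⟩ := h
    exact mem_vertexSet_of_mem_edgeSet he hz
  · calc H.primalGraph.edist x z ≤ H.primalGraph.edist x y + H.primalGraph.edist y z :=
        SimpleGraph.edist_triangle
      _ ≤ t + 1 := add_le_add hy.2 (edist_primalGraph_le_one h)
      _ = ((t + 1 : ℕ) : ℕ∞) := by push_cast; rfl

theorem ball_mono (x : V) {s t : ℕ} (h : s ≤ t) : H.ball x s ⊆ H.ball x t :=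
  fun _ hy => ⟨hy.1, hy.2.trans (by exact_mod_cast h)⟩

theorem mem_ball_succ {x z : V} {t : ℕ} (h : z ∈ H.ball x (t + 1)) :
    z = x ∨ ∃ y ∈ H.ball x t, H.Adj y z := by
  obtain ⟨w, hw⟩ := SimpleGraph.exists_walk_of_edist_ne_top
    (ne_top_of_le_ne_top (ENat.natCast_ne_top _) h.2)
  have hlen : w.length ≤ t + 1 := by
    have := h.2
    rw [← hw] at this
    exact_mod_cast this
  by_cases hzx : z = x
  · exact Or.inl hzx
  · right
    have hnil : ¬ w.Nil := fun hn => hzx hn.eq.symm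
    have hadj := adj_of_primalGraph_adj (w.adj_penultimate hnil)
    refine ⟨w.penultimate, ⟨?_, ?_⟩, hadj⟩
    · obtain ⟨e, he, hz, -⟩ := hadj
      exact mem_vertexSet_of_mem_edgeSet he hz
    · refine (SimpleGraph.edist_le w.dropLast).trans ?_
      have := w.length_dropLast_add_one hnil
      exact_mod_cast (by omega : w.dropLast.length ≤ t)

theorem edist_primalGraph_le_of_walk (n : ℕ) : ∀ (x y : H.vertexSet)
    (p : H.incidenceGraph.Walk (.inl x) (.inl y)), p.length ≤ 2 * n →
    H.primalGraph.edist x.1 y.1 ≤ n := by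
  induction n with
  | zero =>
    intro x y p hp
    have := SimpleGraph.Walk.eq_of_length_eq_zero (Nat.le_zero.1 hp)
    obtain rfl := Sum.inl.inj this
    simp
  | succ n ih =>
    intro x y p hp
    cases p with
    | nil => simp
    | @cons _ e _ h p =>
      rcases e with e | e
      · exact h.elim
      cases p with
      | @cons _ z _ h' q =>
        rcases z with z | z
        · simp only [SimpleGraph.Walk.length_cons] at hp
          have hadj : H.Adj x.1 z.1 := ⟨e.1, e.2, h, h'⟩
          calc H.primalGraph.edist x.1 y.1
              ≤ H.primalGraph.edist x.1 z.1 + H.primalGraph.edist z.1 y.1 :=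
                SimpleGraph.edist_triangle
            _ ≤ 1 + n := add_le_add (edist_primalGraph_le_one hadj) (ih z y q (by omega))
            _ = ((n + 1 : ℕ) : ℕ∞) := by push_cast; exact add_comm _ _
        · exact h'.elim

theorem mem_ball_of_dist_le (hH : H.incidenceGraph.Connected) {x y : H.vertexSet} {t : ℕ}
    (h : H.incidenceGraph.dist (.inl x) (.inl y) ≤ 2 * t) : y.1 ∈ H.ball x.1 t := by
  obtain ⟨p, hp⟩ := hH.exists_walk_length_eq_dist (.inl x) (.inl y)
  exact ⟨y.2, edist_primalGraph_le_of_walk t x y p (hp ▸ h)⟩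

theorem dist_le_of_mem_ball (hH : H.incidenceGraph.Connected) {x : H.vertexSet} {t : ℕ} :
    ∀ {y : H.vertexSet}, y.1 ∈ H.ball x.1 t →
      H.incidenceGraph.dist (.inl x) (.inl y) ≤ 2 * t := by
  induction t with
  | zero =>
    intro y hy
    obtain rfl := Subtype.ext (mem_ball_zero hy)
    simp
  | succ t ih =>
    intro y hy
    rcases mem_ball_succ hy with h | ⟨z, hz, e, he, hze, hye⟩
    · obtain rfl := Subtype.ext h
      simp
    · have h1 := ih (y := ⟨z, hz.1⟩) hz
      have h2 : H.incidenceGraph.Adj (.inl ⟨z, hz.1⟩) (.inr ⟨e, he⟩) := hze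
      have h3 : H.incidenceGraph.Adj (.inr ⟨e, he⟩) (.inl y) := hye
      have h4 := SimpleGraph.dist_eq_one_iff_adj.2 h2
      have h5 := SimpleGraph.dist_eq_one_iff_adj.2 h3
      have h6 := hH.dist_triangle (u := .inl x) (v := .inl ⟨z, hz.1⟩) (w := .inr ⟨e, he⟩)
      have h7 := hH.dist_triangle (u := .inl x) (v := .inr ⟨e, he⟩) (w := .inl y)
      omega

end Hypergraph

/-! ### Coverings that identify neighbourhoods -/

namespace TypedHypergraph

open Hypergraph

variable {A : Type*} {B : Type*} {V : Type*} {W : Type*}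

theorem Isomorphic.symm {H : TypedHypergraph A B V} {H' : TypedHypergraph A B W}
    (h : H.Isomorphic H') : H'.Isomorphic H := by
  obtain ⟨f, g, h1, h2, h3⟩ := h
  refine ⟨f.symm, g.symm, fun x e => ?_, fun x => ?_, fun e => ?_⟩
  · have := h1 (f.symm x) (g.symm e)
    simpa using this.symm
  · have := h2 (f.symm x)
    simpa using this.symm
  · have := h3 (g.symm e)
    simpa using this.symm

/-- A locally surjective type-preserving map which is injective on a ball identifies
neighbourhoods. -/
theorem isomorphic_nbhd_of_covering (T : TypedHypergraph A B V) (H : TypedHypergraph A B W)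
    (f : T.vertexSet → H.vertexSet) (g : T.edgeSet → H.edgeSet)
    (hmem : ∀ x e, x.1 ∈ e.1 → (f x).1 ∈ (g e).1)
    (hedge : ∀ x (e' : H.edgeSet), (f x).1 ∈ e'.1 → ∃ e : T.edgeSet, x.1 ∈ e.1 ∧ g e = e')
    (hvert : ∀ e (z : H.vertexSet), z.1 ∈ (g e).1 → ∃ x : T.vertexSet, x.1 ∈ e.1 ∧ f x = z)
    (hv : ∀ x, H.vtype (f x) = T.vtype x) (he : ∀ e, H.etype (g e) = T.etype e)
    (hne : ∀ e ∈ H.edgeSet, e.Nonempty) (o : T.vertexSet) (t : ℕ)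
    (hinj : ∀ x y : T.vertexSet, x.1 ∈ T.ball o.1 (t + 1) → y.1 ∈ T.ball o.1 (t + 1) →
      f x = f y → x = y) :
    (T.nbhd o.1 t).Isomorphic (H.nbhd (f o).1 t) := by
  have hmaps : ∀ s, ∀ x : T.vertexSet, x.1 ∈ T.ball o.1 s → (f x).1 ∈ H.ball (f o).1 s := by
    intro s
    induction s with
    | zero =>
      intro x hx
      obtain rfl := Subtype.ext (mem_ball_zero hx)
      exact self_mem_ball (f x).2 0
    | succ s ih =>
      intro x hx
      rcases mem_ball_succ hx with h | ⟨y, hy, e, hE, hye, hxe⟩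
      · obtain rfl := Subtype.ext h
        exact self_mem_ball (f x).2 _
      · exact mem_ball_succ_of_adj (ih ⟨y, hy.1⟩ hy)
          ⟨_, (g ⟨e, hE⟩).2, hmem ⟨y, hy.1⟩ ⟨e, hE⟩ hye, hmem x ⟨e, hE⟩ hxe⟩
  have hsurj : ∀ s, ∀ z : H.vertexSet, z.1 ∈ H.ball (f o).1 s →
      ∃ x : T.vertexSet, x.1 ∈ T.ball o.1 s ∧ f x = z := by
    intro s
    induction s with
    | zero =>
      intro z hz
      obtain rfl := Subtype.ext (mem_ball_zero hz)
      exact ⟨o, self_mem_ball o.2 0, rfl⟩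
    | succ s ih =>
      intro z hz
      rcases mem_ball_succ hz with h | ⟨y, hy, e, hE, hye, hze⟩
      · obtain rfl := Subtype.ext h
        exact ⟨o, self_mem_ball o.2 _, rfl⟩
      · obtain ⟨x, hx, hxy⟩ := ih ⟨y, hy.1⟩ hy
        obtain ⟨e₁, hxe, he₁⟩ := hedge x ⟨e, hE⟩ (by rw [hxy]; exact hye)
        obtain ⟨x', hx', hxz⟩ := hvert e₁ z (by rw [he₁]; exact hze)
        exact ⟨x', mem_ball_succ_of_adj hx ⟨e₁.1, e₁.2, hxe, hx'⟩, hxz⟩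
  have hmem' : ∀ (x : T.vertexSet) (e : T.edgeSet), x.1 ∈ T.ball o.1 (t + 1) →
      e.1 ⊆ T.ball o.1 (t + 1) → (f x).1 ∈ (g e).1 → x.1 ∈ e.1 := by
    intro x e hx hE h
    obtain ⟨y, hy, hxy⟩ := hvert e (f x) h
    rwa [← hinj y x (hE hy) hx hxy]
  have hmono := ball_mono (H := T.toHypergraph) o.1 (Nat.le_succ t)
  have hgmaps : ∀ e : T.edgeSet, e.1 ⊆ T.ball o.1 t → (g e).1 ⊆ H.ball (f o).1 t := by
    intro e hE z hz
    obtain ⟨x, hx, hxz⟩ := hvert e ⟨z, H.subset_vertexSet_of_mem_edgeSet' (g e).2 hz⟩ hz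
    have := hmaps t x (hE hx)
    rwa [hxz] at this
  let F : (T.nbhd o.1 t).vertexSet → (H.nbhd (f o).1 t).vertexSet := fun x =>
    ⟨(f ⟨x.1, x.2.1⟩).1, (f ⟨x.1, x.2.1⟩).2, hmaps t ⟨x.1, x.2.1⟩ x.2.2⟩
  let E : (T.nbhd o.1 t).edgeSet → (H.nbhd (f o).1 t).edgeSet := fun e =>
    ⟨(g ⟨e.1, e.2.1⟩).1, (g ⟨e.1, e.2.1⟩).2, hgmaps ⟨e.1, e.2.1⟩ e.2.2⟩
  have hF : Function.Bijective F := by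
    constructor
    · intro x y hxy
      have h1 : f ⟨x.1, x.2.1⟩ = f ⟨y.1, y.2.1⟩ := Subtype.ext (by have h := congrArg Subtype.val hxy; exact h)
      have h2 := hinj _ _ (hmono x.2.2) (hmono y.2.2) h1
      exact Subtype.ext (by have h := congrArg Subtype.val h2; exact h)
    · intro z
      obtain ⟨x, hx, hxz⟩ := hsurj t ⟨z.1, z.2.1⟩ z.2.2
      exact ⟨⟨x.1, x.2, hx⟩, Subtype.ext (by have h := congrArg Subtype.val hxz; exact h)⟩
  have hEb : Function.Bijective E := by
    constructor
    · have key : ∀ e e' : (T.nbhd o.1 t).edgeSet, E e = E e' → e.1 ⊆ e'.1 := by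
        intro e e' hee x hx
        have hxv : x ∈ T.vertexSet := T.subset_vertexSet_of_mem_edgeSet' e.2.1 hx
        refine hmem' ⟨x, hxv⟩ ⟨e'.1, e'.2.1⟩ (hmono (e.2.2 hx)) (e'.2.2.trans hmono) ?_
        have h1 : (g ⟨e.1, e.2.1⟩).1 = (g ⟨e'.1, e'.2.1⟩).1 := by
          have h := congrArg Subtype.val hee
          exact h
        rw [← h1]
        exact hmem ⟨x, hxv⟩ ⟨e.1, e.2.1⟩ hx
      intro e e' hee
      exact Subtype.ext (Set.Subset.antisymm (key e e' hee) (key e' e hee.symm))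
    · intro e'
      obtain ⟨z, hz⟩ := hne e'.1 e'.2.1
      have hzv : z ∈ H.vertexSet := H.subset_vertexSet_of_mem_edgeSet' e'.2.1 hz
      obtain ⟨x, hx, hxz⟩ := hsurj t ⟨z, hzv⟩ (e'.2.2 hz)
      obtain ⟨e, hxe, hee⟩ := hedge x ⟨e'.1, e'.2.1⟩ (by rw [hxz]; exact hz)
      -- A vertex of `e` is a priori only in the ball of radius `t + 1`, while its image has a
      -- preimage in the ball of radius `t`. Injectivity on the larger ball identifies the two,
      -- which is why `hinj` needs the extra unit.
      have hsub : e.1 ⊆ T.ball o.1 t := by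
        intro y hy
        have hyv : y ∈ T.vertexSet := T.subset_vertexSet_of_mem_edgeSet' e.2 hy
        have hyb : y ∈ T.ball o.1 (t + 1) := mem_ball_succ_of_adj hx ⟨e.1, e.2, hxe, hy⟩
        have h1 : (f ⟨y, hyv⟩).1 ∈ e'.1 := by
          have := hmem ⟨y, hyv⟩ e hy
          rwa [hee] at this
        obtain ⟨y', hy', hyy⟩ := hsurj t _ (e'.2.2 h1)
        have h2 := hinj _ _ (hmono hy') hyb hyy
        rw [h2] at hy'
        exact hy'
      exact ⟨⟨e.1, e.2, hsub⟩, Subtype.ext (by have h := congrArg Subtype.val hee; exact h)⟩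
  refine ⟨Equiv.ofBijective F hF, Equiv.ofBijective E hEb, fun x e => ⟨fun h => ?_, fun h => ?_⟩,
    fun x => hv ⟨x.1, x.2.1⟩, fun e => he ⟨e.1, e.2.1⟩⟩
  · exact hmem' ⟨x.1, x.2.1⟩ ⟨e.1, e.2.1⟩ (hmono x.2.2) (e.2.2.trans hmono) h
  · exact hmem ⟨x.1, x.2.1⟩ ⟨e.1, e.2.1⟩ h

/-- The colouring of the incidence graph by the types. -/
def nodeType (H : TypedHypergraph A B V) : H.vertexSet ⊕ H.edgeSet → A ⊕ B :=
  Sum.map H.vtype H.etype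

/-- Two vertices of the ball of radius `t + 1` are at incidence distance at most `2 * (2 * (t + 1))
= 4 * t + 4`, so the covering of `H` by the tree is injective there. -/
theorem isomorphic_nbhd_of_noShortClosedWalk (T : TypedHypergraph A B V)
    (H : TypedHypergraph A B W) (hT : T.incidenceGraph.IsTree) (t : ℕ)
    (hH : H.incidenceGraph.NoShortClosedWalk (4 * t + 4))
    (hloc : ∀ a b, T.nodeType a = H.nodeType b → ∀ c,
      Nonempty ({x // T.incidenceGraph.Adj a x ∧ T.nodeType x = c} ≃
        {y // H.incidenceGraph.Adj b y ∧ H.nodeType y = c}))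
    (hne : ∀ e ∈ H.edgeSet, e.Nonempty) (o : T.vertexSet) (x : H.vertexSet)
    (hox : T.vtype o = H.vtype x) :
    (H.nbhd x.1 t).Isomorphic (T.nbhd o.1 t) := by
  obtain ⟨Φ, hΦo, hcol, hbij⟩ := hT.exists_covering T.nodeType H.nodeType hloc (.inl o) (.inl x)
    (congrArg Sum.inl hox)
  have hf : ∀ y : T.vertexSet, ∃ z : H.vertexSet, Φ (.inl y) = .inl z := by
    intro y
    have := hcol (.inl y)
    rcases h : Φ (.inl y) with z | e
    · exact ⟨z, rfl⟩
    · rw [h] at this; simp [nodeType] at this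
  have hg : ∀ e : T.edgeSet, ∃ e' : H.edgeSet, Φ (.inr e) = .inr e' := by
    intro y
    have := hcol (.inr y)
    rcases h : Φ (.inr y) with z | e
    · rw [h] at this; simp [nodeType] at this
    · exact ⟨e, rfl⟩
  choose f hf using hf
  choose g hg using hg
  have hfo : f o = x := by
    have := hf o
    rw [hΦo] at this
    exact (Sum.inl.inj this).symm
  rw [← hfo]
  refine (isomorphic_nbhd_of_covering T H f g ?_ ?_ ?_ ?_ ?_ hne o t ?_).symm
  · intro y e hy
    have h1 : T.incidenceGraph.Adj (.inl y) (.inr e) := hy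
    have h2 : H.incidenceGraph.Adj (Φ (.inl y)) (Φ (.inr e)) := (hbij (.inl y)).mapsTo h1
    rw [hf, hg] at h2
    exact h2
  · intro y e' he'
    have h1 : H.incidenceGraph.Adj (Φ (.inl y)) (.inr e') := by rw [hf]; exact he'
    obtain ⟨e, he, hee⟩ := (hbij (.inl y)).surjOn h1
    rcases e with z | e
    · exact he.elim
    · exact ⟨e, he, by rw [hg] at hee; exact Sum.inr.inj hee⟩
  · intro e z hz
    have h1 : H.incidenceGraph.Adj (Φ (.inr e)) (.inl z) := by rw [hg]; exact hz
    obtain ⟨y, hy, hyz⟩ := (hbij (.inr e)).surjOn h1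
    rcases y with y | y
    · exact ⟨y, hy, by rw [hf] at hyz; exact Sum.inl.inj hyz⟩
    · exact hy.elim
  · intro y
    have := hcol (.inl y)
    rw [hf] at this
    exact Sum.inl.inj this
  · intro y
    have := hcol (.inr y)
    rw [hg] at this
    exact Sum.inr.inj this
  · intro y z hy hz hyz
    have h1 := dist_le_of_mem_ball hT.1 hy
    have h2 := dist_le_of_mem_ball hT.1 hz
    have h3 := hT.1.dist_triangle (u := .inl y) (v := .inl o) (w := .inl z)
    rw [SimpleGraph.dist_comm] at h1
    have := hT.eq_of_covering_eq hH hbij (a := .inl y) (b := .inl z) (by omega)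
      (by rw [hf, hf, hyz])
    exact Sum.inl.inj this

end TypedHypergraph

/-! ### Finite hypergraphs of large girth -/

/-- Finite groups generated by involutions in which no short reduced word is trivial. -/
theorem exists_involutions_no_short_relation (E : Type u) [Finite E] (r : ℕ) :
    ∃ (Γ : Type u) (_ : Group Γ) (_ : Finite Γ) (γ : E → Γ), (∀ e, γ e * γ e = 1) ∧
      ∀ (e : ℕ → E) (g : ℕ → Γ) (n : ℕ), 0 < n → n ≤ r →
        (∀ l < n, g (l + 1) = γ (e l) * g l) → (∀ l, l + 1 < n → e l ≠ e (l + 1)) →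
        g n ≠ g 0 := by
  classical
  let S := {l : List E // l.IsChain (· ≠ ·) ∧ l.length ≤ r}
  have : Finite S := ((List.finite_length_le E r).subset (fun l hl => hl.2) :
    Set.Finite {l : List E | l.IsChain (· ≠ ·) ∧ l.length ≤ r})
  -- Each generator acts on reduced words of length at most `r`: cancel a leading `e`, else prepend
  -- `e`, else (no room left) fix the word.
  let step : E → S → S := fun e l =>
    if h : l.1.head? = some e then ⟨l.1.tail, l.2.1.tail, by
      have := l.2.2
      rw [List.length_tail]; omega⟩
    else if h' : l.1.length < r then ⟨e :: l.1, by
        rw [List.isChain_cons]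
        refine ⟨fun y hy he => h ?_, l.2.1⟩
        rw [he]; exact hy, by simpa using h'⟩
    else l
  have hstep : ∀ e, Function.Involutive (step e) := by
    rintro e ⟨l, hl, hr⟩
    by_cases h : l.head? = some e
    · cases l with
      | nil => simp at h
      | cons a l =>
        obtain rfl : a = e := by simpa using h
        rw [List.isChain_cons] at hl
        have h1 : l.head? ≠ some a := fun hh => hl.1 a hh rfl
        have h2 : l.length < r := by simpa using hr
        simp [step, h1, h2]
    · by_cases h' : l.length < r
      · simp [step, h, h']
      · simp [step, h, h']
  refine ⟨Equiv.Perm S, inferInstance, inferInstance, fun e => (hstep e).toPerm, fun e => ?_, ?_⟩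
  · ext1 l
    exact hstep e l
  · intro e g n hn hnr hg he heq
    -- Follow the empty word. Consecutive labels differ and `n ≤ r`, so no step cancels or stalls;
    -- the word has length `n > 0` at the end, whereas `g n = g 0` would return the empty word.
    have key : ∀ l, l ≤ n →
        ((g l * (g 0)⁻¹) ⟨[], by simp⟩).1.length = l ∧
        ∀ m, l = m + 1 → ((g l * (g 0)⁻¹) ⟨[], by simp⟩).1.head? = some (e m) := by
      intro l
      induction l with
      | zero => intro _; simp
      | succ l ih =>
        intro hl
        obtain ⟨h1, h2⟩ := ih (by omega)
        rw [hg l (by omega), mul_assoc, Equiv.Perm.mul_apply]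
        set z := (g l * (g 0)⁻¹) ⟨[], by simp⟩ with hz
        have h3 : z.1.head? ≠ some (e l) := by
          cases l with
          | zero =>
            have : z.1 = [] := List.eq_nil_of_length_eq_zero h1
            simp [this]
          | succ m =>
            rw [h2 m rfl]
            intro hh
            exact he m (by omega) (Option.some.inj hh)
        have h4 : z.1.length < r := by omega
        have h5 : (step (e l) z).1 = e l :: z.1 := by
          simp [step, h3, h4]
        refine ⟨?_, ?_⟩
        · change (step (e l) z).1.length = _
          rw [h5]; simp [h1]
        · rintro m hm
          obtain rfl : l = m := by omega
          change (step (e l) z).1.head? = _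
          rw [h5]; simp
    have h1 := (key n le_rfl).1
    rw [heq] at h1
    simp at h1
    omega

/-- A finite incidence structure without repeated blocks is realised by a finite hypergraph. -/
theorem exists_finiteTypedHypergraph {A : Type u} {B : Type v} {α β : Type w} [Finite α]
    (I : α → β → Prop) (hI : ∀ b b', (∀ a, I a b ↔ I a b') → b = b') (cα : α → A) (cβ : β → B)
    (hc : Function.Surjective cα) :
    ∃ (H : FiniteTypedHypergraph A B) (f : α ≃ H.vertexSet) (g : β ≃ H.edgeSet),
      (∀ a b, (f a).1 ∈ (g b).1 ↔ I a b) ∧ (∀ a, H.vtype (f a) = cα a) ∧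
      ∀ b, H.etype (g b) = cβ b := by
  obtain ⟨n, ⟨ε⟩⟩ := Finite.exists_equiv_fin α
  let ι : α → ℕ := fun a => (ε a).1
  have hι : Function.Injective ι := fun a b h => ε.injective (Fin.ext h)
  let κ : β → Set ℕ := fun b => ι '' {a | I a b}
  have hκ : ∀ a b, ι a ∈ κ b ↔ I a b := fun a b => by
    constructor
    · rintro ⟨a', ha', h⟩
      rwa [← hι h]
    · intro h
      exact ⟨a, h, rfl⟩
  have hκi : Function.Injective κ := fun b b' h => hI b b' fun a => by rw [← hκ, ← hκ, h]
  let f : α ≃ Set.range ι := Equiv.ofInjective ι hι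
  let g : β ≃ Set.range κ := Equiv.ofInjective κ hκi
  refine ⟨
    { vertexSet := Set.range ι
      edgeSet := Set.range κ
      subset_vertexSet_of_mem_edgeSet' := ?_
      vtype := fun x => cα (f.symm x)
      etype := fun e => cβ (g.symm e)
      finite_vertexSet := Set.finite_range ι
      vtype_surjective := hc.comp f.symm.surjective }, f, g, hκ, fun a => ?_, fun b => ?_⟩
  · rintro _ ⟨b, rfl⟩ _ ⟨a, -, rfl⟩
    exact ⟨a, rfl⟩
  · exact congrArg cα (f.symm_apply_apply a)
  · exact congrArg cβ (g.symm_apply_apply b)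

/-- A finite bipartite multigraph with types has finite typed coverings of large girth. -/
theorem exists_finite_cover {A : Type u} {B : Type v} {X Y E : Type w} [Finite X] [Finite Y]
    [Finite E] (s : E → X) (t : E → Y) (cX : X → A) (cY : Y → B) (hc : Function.Surjective cX)
    (D : A → B → ℕ) (K : B → A → ℕ)
    (hD : ∀ x j, Nat.card {e // s e = x ∧ cY (t e) = j} = D (cX x) j)
    (hK : ∀ y i, Nat.card {e // t e = y ∧ cX (s e) = i} = K (cY y) i)
    (h2 : ∀ y, ∃ e e', e ≠ e' ∧ t e = y ∧ t e' = y) (r : ℕ) :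
    ∃ H : FiniteTypedHypergraph A B, H.incidenceGraph.NoShortClosedWalk r ∧
      (∀ (x : H.vertexSet) j,
        Nat.card {e : H.edgeSet // x.1 ∈ e.1 ∧ H.etype e = j} = D (H.vtype x) j) ∧
      (∀ (e : H.edgeSet) i,
        Nat.card {x : H.vertexSet // x.1 ∈ e.1 ∧ H.vtype x = i} = K (H.etype e) i) ∧
      ∀ e ∈ H.edgeSet, e.Nonempty := by
  -- Besides `r`, lengths 2 and 4 are needed: the first makes `γ` injective, the second keeps blocks
  -- with the same vertices from arising.
  obtain ⟨Γ, _, _, γ, hγ, hrel⟩ := exists_involutions_no_short_relation E (max r 4)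
  have hγγ : ∀ e g, γ e * (γ e * g) = g := fun e g => by rw [← mul_assoc, hγ, one_mul]
  have hγi : Function.Injective γ := by
    intro e e' h
    by_contra hne
    refine hrel (fun l => if l = 0 then e else e') (fun l => if l = 1 then γ e else 1) 2
      (by omega) (by omega) ?_ ?_ (by simp)
    · intro l hl
      interval_cases l
      · simp
      · simp [h, hγ]
    · intro l hl
      obtain rfl : l = 0 := by omega
      simpa using hne
  let I : X × Γ → Y × Γ → Prop := fun a b => ∃ e, s e = a.1 ∧ t e = b.1 ∧ b.2 = γ e * a.2
  -- Crossing a lift of `e` in either direction multiplies the group coordinate by `γ e`, because `γ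
  -- e` is an involution.
  let L : E → (X × Γ) ⊕ (Y × Γ) → (X × Γ) ⊕ (Y × Γ) → Prop := fun e p q =>
    match p, q with
    | .inl a, .inr b => s e = a.1 ∧ t e = b.1 ∧ b.2 = γ e * a.2
    | .inr b, .inl a => s e = a.1 ∧ t e = b.1 ∧ b.2 = γ e * a.2
    | _, _ => False
  let gc : (X × Γ) ⊕ (Y × Γ) → Γ := Sum.elim Prod.snd Prod.snd
  have hLg : ∀ e p q, L e p q → gc q = γ e * gc p := by
    rintro e (a | b) (a' | b') h
    · exact h.elim
    · exact h.2.2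
    · have h' : b.2 = γ e * a'.2 := h.2.2
      change a'.2 = γ e * b.2
      rw [h', hγγ]
    · exact h.elim
  -- The label and one end of a lifted edge determine the other end, so a non-backtracking walk has
  -- distinct consecutive labels.
  have hLb : ∀ e p q p', L e p q → L e q p' → p = p' := by
    intro e p q p' h h'
    have h1 : gc p = gc p' := by
      have h3 := hLg _ _ _ h
      rw [hLg _ _ _ h', h3, hγγ]
    rcases p with a | b <;> rcases q with a' | b' <;> rcases p' with a'' | b'' <;>
      first
      | exact h.elim
      | exact h'.elim
      | skip
    · exact congrArg Sum.inl (Prod.ext (h.1.symm.trans h'.1) h1)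
    · exact congrArg Sum.inr (Prod.ext (h.2.1.symm.trans h'.2.1) h1)
  have hwalk : ∀ (w : ℕ → (X × Γ) ⊕ (Y × Γ)) (n : ℕ), 0 < n → n ≤ max r 4 →
      (∀ l < n, ∃ e, L e (w l) (w (l + 1))) → (∀ l, l + 1 < n → w l ≠ w (l + 2)) →
      w 0 ≠ w n := by
    intro w n hn hnr hL hw h0
    have hL' : ∀ l, ∃ e, l < n → L e (w l) (w (l + 1)) := by
      intro l
      by_cases hl : l < n
      · obtain ⟨e, he⟩ := hL l hl
        exact ⟨e, fun _ => he⟩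
      · obtain ⟨e, he⟩ := hL 0 hn
        exact ⟨e, fun h => absurd h hl⟩
    choose e he using hL'
    refine hrel e (fun l => gc (w l)) n hn hnr (fun l hl => hLg _ _ _ (he l hl)) ?_
      (congrArg gc h0.symm)
    intro l hl hee
    refine hw l hl (hLb (e l) _ _ _ (he l (by omega)) ?_)
    rw [hee]
    exact he (l + 1) hl
  -- Two distinct blocks with the same vertices share at least two of them, which closes a
  -- non-backtracking walk of length 4.
  have hII : ∀ b b', (∀ a, I a b ↔ I a b') → b = b' := by
    intro b b' hbb
    by_contra hne
    obtain ⟨e, e', hee, h1, h2⟩ := h2 b.1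
    have ha : ∀ e, t e = b.1 → L e (.inl (s e, γ e * b.2)) (.inr b) := fun e he =>
      ⟨rfl, he, (hγγ _ _).symm⟩
    have ha' : ∀ e, t e = b.1 → ∃ e'', L e'' (.inl (s e, γ e * b.2)) (.inr b') := fun e he =>
      (hbb (s e, γ e * b.2)).1 ⟨e, ha e he⟩
    let w : ℕ → (X × Γ) ⊕ (Y × Γ) := fun l =>
      if l = 1 then .inr b else if l = 2 then .inl (s e', γ e' * b.2) else
        if l = 3 then .inr b' else .inl (s e, γ e * b.2)
    have hsymm : ∀ e p q, L e p q → L e q p := by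
      rintro e (a | b) (a' | b') h <;> exact h
    refine hwalk w 4 (by omega) (by omega) ?_ ?_ (by simp [w])
    · intro l hl
      interval_cases l
      · exact ⟨e, ha e h1⟩
      · exact ⟨e', hsymm e' (.inl (s e', γ e' * b.2)) (.inr b) (ha e' h2)⟩
      · exact ha' e' h2
      · obtain ⟨e'', h⟩ := ha' e h1
        exact ⟨e'', hsymm e'' (.inl (s e, γ e * b.2)) (.inr b') h⟩
    · have h3 : γ e * b.2 ≠ γ e' * b.2 := fun h => hee (hγi (mul_right_cancel h))
      intro l hl
      have : l < 3 := by omega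
      interval_cases l
      · intro h
        exact h3 (Prod.ext_iff.1 (Sum.inl.inj h)).2
      · intro h
        exact hne (Sum.inr.inj h)
      · intro h
        exact h3 (Prod.ext_iff.1 (Sum.inl.inj h)).2.symm
  have hcov : Function.Surjective fun a : X × Γ => cX a.1 := fun i => by
    obtain ⟨x, hx⟩ := hc i
    exact ⟨(x, 1), hx⟩
  obtain ⟨H, f, g, hfg, hf, hg⟩ := exists_finiteTypedHypergraph I hII (fun a => cX a.1)
    (fun b => cY b.1) hcov
  refine ⟨H, ?_, ?_, ?_, ?_⟩
  · intro w n hn hnr hadj hnb h0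
    refine hwalk (fun l => Sum.map f.symm g.symm (w l)) n hn (hnr.trans (le_max_left _ _)) ?_ ?_
      (congrArg _ h0)
    · intro l hl
      have h := hadj l hl
      generalize w l = p at h
      generalize w (l + 1) = q at h
      rcases p with x | y <;> rcases q with x' | y'
      · exact h.elim
      · have h' : x.1 ∈ y'.1 := h
        rw [← f.apply_symm_apply x, ← g.apply_symm_apply y', hfg] at h'
        exact h'
      · have h' : x'.1 ∈ y.1 := h
        rw [← f.apply_symm_apply x', ← g.apply_symm_apply y, hfg] at h'
        exact h'
      · exact h.elim
    · intro l hl h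
      exact hnb l hl (Sum.map_injective.2 ⟨f.symm.injective, g.symm.injective⟩ h)
  · intro x j
    obtain ⟨⟨x, k⟩, rfl⟩ := f.surjective x
    rw [hf, ← hD]
    symm
    refine Nat.card_eq_of_bijective (fun e => ⟨g (t e.1, γ e.1 * k),
      (hfg _ _).2 ⟨e.1, e.2.1, rfl, rfl⟩, (hg _).trans e.2.2⟩) ⟨?_, ?_⟩
    · intro e e' h
      have h1 := g.injective (congrArg Subtype.val h)
      exact Subtype.ext (hγi (mul_right_cancel (Prod.ext_iff.1 h1).2))
    · rintro ⟨y, hy, hj⟩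
      obtain ⟨⟨y, k'⟩, rfl⟩ := g.surjective y
      obtain ⟨e, h1, h2, h3⟩ := (hfg _ _).1 hy
      rw [hg] at hj
      dsimp only at h1 h2 h3 hj
      exact ⟨⟨e, h1, by rw [h2]; exact hj⟩, Subtype.ext (congrArg g (Prod.ext h2 h3.symm))⟩
  · intro y i
    obtain ⟨⟨y, k⟩, rfl⟩ := g.surjective y
    rw [hg, ← hK]
    symm
    refine Nat.card_eq_of_bijective (fun e => ⟨f (s e.1, γ e.1 * k),
      (hfg _ _).2 ⟨e.1, rfl, e.2.1, (hγγ _ _).symm⟩, (hf _).trans e.2.2⟩) ⟨?_, ?_⟩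
    · intro e e' h
      have h1 := f.injective (congrArg Subtype.val h)
      exact Subtype.ext (hγi (mul_right_cancel (Prod.ext_iff.1 h1).2))
    · rintro ⟨x, hx, hi⟩
      obtain ⟨⟨x, k'⟩, rfl⟩ := f.surjective x
      obtain ⟨e, h1, h2, h3⟩ := (hfg _ _).1 hx
      rw [hf] at hi
      dsimp only at h1 h2 h3 hi
      exact ⟨⟨e, h2, by rw [h1]; exact hi⟩,
        Subtype.ext (congrArg f (Prod.ext h1 (by simp only [h3, hγγ])))⟩
  · intro y hy
    obtain ⟨⟨y', k⟩, hyk⟩ := g.surjective ⟨y, hy⟩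
    obtain ⟨e, -, -, he, -⟩ := h2 y'
    have := (hfg (s e, γ e * k) (y', k)).2 ⟨e, rfl, he, (hγγ _ _).symm⟩
    rw [hyk] at this
    exact ⟨_, this⟩

/-- Integer solutions of the balance equations give finite typed hypergraphs of large girth with
the prescribed branching numbers. -/
theorem exists_hypergraph_of_balanced {A B : Type u} [Finite A] [Finite B] (D : A → B → ℕ)
    (K : B → A → ℕ) (n : A → ℕ) (m : B → ℕ) (hn : ∀ i, 0 < n i)
    (h : ∀ i j, n i * D i j = m j * K j i) (h2 : ∀ j, Nontrivial (Σ i, Fin (K j i))) (r : ℕ) :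
    ∃ H : FiniteTypedHypergraph A B, H.incidenceGraph.NoShortClosedWalk r ∧
      (∀ (x : H.vertexSet) j,
        Nat.card {e : H.edgeSet // x.1 ∈ e.1 ∧ H.etype e = j} = D (H.vtype x) j) ∧
      (∀ (e : H.edgeSet) i,
        Nat.card {x : H.vertexSet // x.1 ∈ e.1 ∧ H.vtype x = i} = K (H.etype e) i) ∧
      ∀ e ∈ H.edgeSet, e.Nonempty := by
  -- The balance equation says that the half-edges leaving vertices of type `i` towards type `j` are
  -- as many as those leaving hyperedges of type `j` towards type `i`; any bijection glues them into
  -- a multigraph.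
  let ε : ∀ i j, Fin (n i) × Fin (D i j) ≃ Fin (m j) × Fin (K j i) := fun i j =>
    finProdFinEquiv.trans ((finCongr (h i j)).trans finProdFinEquiv.symm)
  let s : (Σ p : A × B, Fin (n p.1) × Fin (D p.1 p.2)) → Σ i, Fin (n i) := fun e =>
    ⟨e.1.1, e.2.1⟩
  let t : (Σ p : A × B, Fin (n p.1) × Fin (D p.1 p.2)) → Σ j, Fin (m j) := fun e =>
    ⟨e.1.2, (ε _ _ e.2).1⟩
  refine exists_finite_cover s t Sigma.fst Sigma.fst (fun i => ⟨⟨i, ⟨0, hn i⟩⟩, rfl⟩) D K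
    ?_ ?_ ?_ r
  · rintro ⟨i, a⟩ j
    rw [← Nat.card_fin (D i j)]
    symm
    refine Nat.card_eq_of_bijective
      (fun c : Fin (D i j) => ⟨⟨(i, j), (a, c)⟩, rfl, rfl⟩) ⟨?_, ?_⟩
    · intro c c' hcc
      have := congrArg Subtype.val hcc
      simpa using this
    · rintro ⟨⟨⟨i', j'⟩, a', c⟩, hs, hj⟩
      obtain rfl : j' = j := hj
      obtain ⟨rfl, ha⟩ := Sigma.mk.inj_iff.1 hs
      obtain rfl := eq_of_heq ha
      exact ⟨c, rfl⟩
  · rintro ⟨j, b⟩ i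
    rw [← Nat.card_fin (K j i)]
    symm
    refine Nat.card_eq_of_bijective
      (fun c : Fin (K j i) => ⟨⟨(i, j), (ε i j).symm (b, c)⟩, by simp [t], rfl⟩) ⟨?_, ?_⟩
    · intro c c' hcc
      have := congrArg Subtype.val hcc
      simpa using this
    · rintro ⟨⟨⟨i', j'⟩, z⟩, ht, hi⟩
      obtain rfl : i' = i := hi
      obtain ⟨rfl, hb⟩ := Sigma.mk.inj_iff.1 ht
      obtain rfl := eq_of_heq hb
      exact ⟨(ε i' j' z).2, by simp⟩
  · rintro ⟨j, b⟩
    obtain ⟨⟨i, c⟩, ⟨i', c'⟩, hne⟩ := (h2 j).exists_pair_ne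
    refine ⟨⟨(i, j), (ε i j).symm (b, c)⟩, ⟨(i', j), (ε i' j).symm (b, c')⟩, ?_, by simp [t],
      by simp [t]⟩
    intro heq
    apply hne
    obtain ⟨h1, h2⟩ := Sigma.mk.inj_iff.1 heq
    obtain rfl : i = i' := congrArg Prod.fst h1
    have := (ε i j).symm.injective (eq_of_heq h2)
    rw [show c = c' from congrArg Prod.snd this]

/-! ### Integer weights from rational ratios -/

theorem exists_nat_multiple {C : Type*} [Finite C] (q : C → ℚ) (hq : ∀ c, 0 < q c) :
    ∃ (N : ℕ) (n : C → ℕ), 0 < N ∧ (∀ c, 0 < n c) ∧ ∀ c, (n c : ℚ) = q c * N := by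
  have := Fintype.ofFinite C
  have key : ∀ c, ∃ m : ℕ, (m : ℚ) = q c * ((∏ c, (q c).den : ℕ) : ℚ) := by
    intro c
    obtain ⟨M, hM⟩ := Finset.dvd_prod_of_mem (fun c => (q c).den) (Finset.mem_univ c)
    refine ⟨(q c).num.toNat * M, ?_⟩
    rw [hM]
    push_cast
    rw [← mul_assoc, Rat.mul_den_eq_num]
    congr 1
    have : ((q c).num.toNat : ℤ) = (q c).num :=
      Int.toNat_of_nonneg (Rat.num_nonneg.2 (hq c).le)
    exact_mod_cast this
  choose n hn using key
  have hN : 0 < ∏ c, (q c).den := Finset.prod_pos fun c _ => (q c).den_pos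
  refine ⟨_, n, hN, fun c => ?_, hn⟩
  have : (0 : ℚ) < n c := by
    rw [hn]
    exact mul_pos (hq c) (by exact_mod_cast hN)
  exact_mod_cast this

/-- Positive rational ratios propagate along a connected graph. -/
theorem SimpleGraph.Connected.exists_nat_weights {N C : Type*} [Finite C] {Γ : SimpleGraph N}
    (hΓ : Γ.Connected) (c : N → C) (hc : Function.Surjective c) (w : C → ℝ) (a b : N → N → ℕ)
    (ha : ∀ x y, Γ.Adj x y → 0 < a x y) (hb : ∀ x y, Γ.Adj x y → 0 < b x y)
    (hw : ∀ x y, Γ.Adj x y → w (c x) * a x y = w (c y) * b x y) (c₀ : C) (h₀ : 0 < w c₀) :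
    ∃ (l : ℝ) (n : C → ℕ), (∀ i, 0 < n i) ∧ ∀ i, (n i : ℝ) = l * w i := by
  have hq : ∀ i, ∃ q : ℚ, 0 < q ∧ w i = q * w c₀ := by
    intro i
    obtain ⟨x, rfl⟩ := hc i
    obtain ⟨z, rfl⟩ := hc c₀
    obtain ⟨p⟩ := hΓ.preconnected x z
    induction p with
    | nil => exact ⟨1, by simp, by simp⟩
    | @cons x y z h p ih =>
      obtain ⟨q, hq, hy⟩ := ih h₀
      have h1 : (0 : ℚ) < a x y := by exact_mod_cast ha x y h
      have h2 : (0 : ℚ) < b x y := by exact_mod_cast hb x y h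
      have h3 : (0 : ℝ) < a x y := by exact_mod_cast ha x y h
      -- Solve `w (c x) * a = w (c y) * b` for `w (c x)`.
      refine ⟨q * b x y / a x y, by positivity, ?_⟩
      have := hw x y h
      push_cast
      field_simp
      rw [this, hy]
      ring
  choose q hq hw' using hq
  obtain ⟨N, n, hN, hn, hnq⟩ := exists_nat_multiple q hq
  refine ⟨N / w c₀, n, hn, fun i => ?_⟩
  have h1 : (n i : ℝ) = q i * N := by exact_mod_cast hnq i
  rw [h1, hw' i]
  field_simp

/-! ### Branching numbers and balance in a regular hypertree -/

namespace Hypergraph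

variable {V : Type u} {T : Hypergraph V} {k d : ℕ}

/-- `ncard` is `0` on infinite sets, so the positive value `d + 1` already forces finiteness. -/
theorem IsRegularHypertree.finite_edges (hT : T.IsRegularHypertree k d) (x : T.vertexSet) :
    Finite {e : T.edgeSet // x.1 ∈ e.1} := by
  have h : {e | e ∈ T.edgeSet ∧ x.1 ∈ e}.Finite :=
    Set.finite_of_ncard_pos (by rw [hT.regular x.1 x.2]; omega)
  have := h.to_subtype
  exact Finite.of_injective
    (fun e : {e : T.edgeSet // x.1 ∈ e.1} =>
      (⟨e.1.1, e.1.2, e.2⟩ : {e | e ∈ T.edgeSet ∧ x.1 ∈ e}))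
    (fun e e' h => Subtype.ext (Subtype.ext (by have h' := congrArg Subtype.val h; exact h')))

theorem IsRegularHypertree.finite_vertices (hT : T.IsRegularHypertree k d) (e : T.edgeSet) :
    Finite {x : T.vertexSet // x.1 ∈ e.1} := by
  have h : e.1.Finite := Set.finite_of_ncard_pos (by rw [hT.uniform e.1 e.2]; omega)
  have := h.to_subtype
  exact Finite.of_injective (fun x : {x : T.vertexSet // x.1 ∈ e.1} => (⟨x.1.1, x.2⟩ : e.1))
    (fun e e' h => Subtype.ext (Subtype.ext (by have h' := congrArg Subtype.val h; exact h')))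

theorem IsRegularHypertree.exists_ne_edges (hT : T.IsRegularHypertree k d) (hd : 1 ≤ d)
    (x : T.vertexSet) : ∃ e e' : T.edgeSet, e ≠ e' ∧ x.1 ∈ e.1 ∧ x.1 ∈ e'.1 := by
  have h := hT.regular x.1 x.2
  obtain ⟨e, he, e', he', hne⟩ := (Set.one_lt_ncard (Set.finite_of_ncard_pos (by omega))).1
    (by rw [h]; omega : 1 < {e | e ∈ T.edgeSet ∧ x.1 ∈ e}.ncard)
  exact ⟨⟨e, he.1⟩, ⟨e', he'.1⟩, fun h => hne (congrArg Subtype.val h), he.2, he'.2⟩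

theorem IsRegularHypertree.exists_ne_vertices (hT : T.IsRegularHypertree k d) (hk : 1 ≤ k)
    (e : T.edgeSet) : ∃ x x' : T.vertexSet, x ≠ x' ∧ x.1 ∈ e.1 ∧ x'.1 ∈ e.1 := by
  have h := hT.uniform e.1 e.2
  obtain ⟨x, hx, x', hx', hne⟩ := (Set.one_lt_ncard (Set.finite_of_ncard_pos (by omega))).1
    (by rw [h]; omega : 1 < e.1.ncard)
  have hs := T.subset_vertexSet_of_mem_edgeSet' e.2
  exact ⟨⟨x, hs hx⟩, ⟨x', hs hx'⟩, fun h => hne (congrArg Subtype.val h), hx, hx'⟩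

theorem IsRegularHypertree.vertexSet_nonempty (hT : T.IsRegularHypertree k d) (hk : 1 ≤ k) :
    Nonempty T.vertexSet := by
  obtain ⟨x | e⟩ := hT.isTree.1.nonempty
  · exact ⟨x⟩
  · obtain ⟨x, -⟩ := hT.exists_ne_vertices hk e
    exact ⟨x⟩

variable (G : Subgroup T.autGroup)

theorem branchingD_apply (x : T.vertexSet) (j : EdgeOrbit G) :
    branchingD G (vertexOrbit G x) j = Nat.card {e : T.edgeSet // x.1 ∈ e.1 ∧ edgeOrbit G e = j} :=
  rfl

theorem branchingK_apply (e : T.edgeSet) (i : VertexOrbit G) :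
    branchingK G (edgeOrbit G e) i =
      Nat.card {x : T.vertexSet // x.1 ∈ e.1 ∧ vertexOrbit G x = i} :=
  rfl

theorem vertexOrbit_surjective : Function.Surjective (vertexOrbit G) := Quotient.mk_surjective

theorem edgeOrbit_surjective : Function.Surjective (edgeOrbit G) := Quotient.mk_surjective

variable {G}

theorem IsRegularHypertree.finite_edges_of_type (hT : T.IsRegularHypertree k d)
    (x : T.vertexSet) (j : EdgeOrbit G) :
    Finite {e : T.edgeSet // x.1 ∈ e.1 ∧ edgeOrbit G e = j} := by
  have := hT.finite_edges x
  exact Finite.of_injective (fun e => (⟨e.1, e.2.1⟩ : {e : T.edgeSet // x.1 ∈ e.1}))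
    (fun e e' h => Subtype.ext (by have h' := congrArg Subtype.val h; exact h'))

theorem IsRegularHypertree.finite_vertices_of_type (hT : T.IsRegularHypertree k d)
    (e : T.edgeSet) (i : VertexOrbit G) :
    Finite {x : T.vertexSet // x.1 ∈ e.1 ∧ vertexOrbit G x = i} := by
  have := hT.finite_vertices e
  exact Finite.of_injective (fun x => (⟨x.1, x.2.1⟩ : {x : T.vertexSet // x.1 ∈ e.1}))
    (fun e e' h => Subtype.ext (by have h' := congrArg Subtype.val h; exact h'))

theorem IsRegularHypertree.branchingD_pos (hT : T.IsRegularHypertree k d) {x : T.vertexSet}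
    {e : T.edgeSet} (h : x.1 ∈ e.1) : 0 < branchingD G (vertexOrbit G x) (edgeOrbit G e) := by
  have := hT.finite_edges_of_type (G := G) x (edgeOrbit G e)
  rw [branchingD_apply]
  have : Nonempty {e' : T.edgeSet // x.1 ∈ e'.1 ∧ edgeOrbit G e' = edgeOrbit G e} := ⟨⟨e, h, rfl⟩⟩
  exact Nat.card_pos

theorem IsRegularHypertree.branchingK_pos (hT : T.IsRegularHypertree k d) {x : T.vertexSet}
    {e : T.edgeSet} (h : x.1 ∈ e.1) : 0 < branchingK G (edgeOrbit G e) (vertexOrbit G x) := by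
  have := hT.finite_vertices_of_type (G := G) e (vertexOrbit G x)
  rw [branchingK_apply]
  have : Nonempty {x' : T.vertexSet // x'.1 ∈ e.1 ∧ vertexOrbit G x' = vertexOrbit G x} :=
    ⟨⟨x, h, rfl⟩⟩
  exact Nat.card_pos

/-- Sorting the vertices of a hyperedge by type identifies them with this sigma type. It supplies
the two incidences per block that the finite cover needs. -/
theorem IsRegularHypertree.nontrivial_sigma_branchingK (hT : T.IsRegularHypertree k d)
    (hk : 1 ≤ k) (j : EdgeOrbit G) : Nontrivial (Σ i, Fin (branchingK G j i)) := by
  obtain ⟨e, rfl⟩ := edgeOrbit_surjective G j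
  have hf : ∀ i, Nonempty ({x : {x : T.vertexSet // x.1 ∈ e.1} // vertexOrbit G x.1 = i} ≃
      Fin (branchingK G (edgeOrbit G e) i)) := by
    intro i
    have := hT.finite_vertices_of_type (G := G) e i
    exact ⟨(Equiv.subtypeSubtypeEquivSubtypeInter _ (fun x => vertexOrbit G x = i)).trans
      (Finite.equivFinOfCardEq (branchingK_apply G e i).symm)⟩
  let φ : {x : T.vertexSet // x.1 ∈ e.1} ≃ Σ i, Fin (branchingK G (edgeOrbit G e) i) :=
    (Equiv.sigmaFiberEquiv (fun x : {x : T.vertexSet // x.1 ∈ e.1} => vertexOrbit G x.1)).symm.trans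
      (Equiv.sigmaCongrRight fun i => (hf i).some)
  obtain ⟨x, x', hne, hx, hx'⟩ := hT.exists_ne_vertices hk e
  have : Nontrivial {x : T.vertexSet // x.1 ∈ e.1} :=
    ⟨⟨x, hx⟩, ⟨x', hx'⟩, fun h => hne (congrArg Subtype.val h)⟩
  exact φ.symm.nontrivial

/-- The detailed balance equations, entry by entry. -/
theorem detailedBalance_iff [Fintype (VertexOrbit G)] [Fintype (EdgeOrbit G)]
    (p : VertexOrbit G ⊕ EdgeOrbit G → ℝ) :
    (∀ x y, p x * projectedChain G k d x y = p y * projectedChain G k d y x) ↔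
      ∀ i j, p (.inl i) / (d + 1) * branchingD G i j = p (.inr j) / (k + 1) * branchingK G j i := by
  have key : ∀ i j, p (.inl i) * projectedChain G k d (.inl i) (.inr j) =
      p (.inl i) / (d + 1) * branchingD G i j := fun i j => by
    simp [projectedChain]; ring
  have key' : ∀ i j, p (.inr j) * projectedChain G k d (.inr j) (.inl i) =
      p (.inr j) / (k + 1) * branchingK G j i := fun i j => by
    simp [projectedChain]; ring
  constructor
  · intro h i j
    rw [← key, ← key', h]
  · rintro h (i | j) (i' | j')
    · simp [projectedChain]
    · rw [key, key', h]
    · rw [key, key', h]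
    · simp [projectedChain]

theorem IsRegularHypertree.exists_nat_weights [Fintype (VertexOrbit G)] [Fintype (EdgeOrbit G)]
    (hT : T.IsRegularHypertree k d) (h : IsTimeReversible (projectedChain G k d)) :
    ∃ (n : VertexOrbit G → ℕ) (m : EdgeOrbit G → ℕ), (∀ i, 0 < n i) ∧
      ∀ i j, n i * branchingD G i j = m j * branchingK G j i := by
  obtain ⟨p, h0, h1, hp⟩ := h
  rw [detailedBalance_iff] at hp
  let w : VertexOrbit G ⊕ EdgeOrbit G → ℝ :=
    Sum.elim (fun i => p (.inl i) / (d + 1)) (fun j => p (.inr j) / (k + 1))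
  -- One positive weight is enough: positivity then spreads over the connected incidence graph.
  obtain ⟨c, hc⟩ : ∃ c, 0 < w c := by
    obtain ⟨c, -, hc⟩ := Finset.exists_ne_zero_of_sum_ne_zero (by rw [h1]; exact one_ne_zero)
    have hc' : 0 < p c := lt_of_le_of_ne (h0 c) hc.symm
    refine ⟨c, ?_⟩
    rcases c with i | j <;> simp only [w, Sum.elim_inl, Sum.elim_inr] <;> positivity
  let a : T.vertexSet ⊕ T.edgeSet → T.vertexSet ⊕ T.edgeSet → ℕ := fun x y =>
    match x, y with
    | .inl x, .inr e => branchingD G (vertexOrbit G x) (edgeOrbit G e)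
    | .inr e, .inl x => branchingK G (edgeOrbit G e) (vertexOrbit G x)
    | _, _ => 0
  have ha : ∀ x y, T.incidenceGraph.Adj x y → 0 < a x y := by
    rintro (x | e) (x' | e') hx
    · exact hx.elim
    · exact hT.branchingD_pos hx
    · exact hT.branchingK_pos hx
    · exact hx.elim
  have hw : ∀ x y, T.incidenceGraph.Adj x y →
      w ((T.labelled G).nodeType x) * a x y = w ((T.labelled G).nodeType y) * a y x := by
    rintro (x | e) (x' | e') hx
    · exact hx.elim
    · exact hp _ _
    · exact (hp _ _).symm
    · exact hx.elim
  obtain ⟨l, n, hn, hl⟩ := hT.isTree.1.exists_nat_weights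
    (T.labelled G).nodeType ((vertexOrbit_surjective G).sumMap (edgeOrbit_surjective G)) w a
    (fun x y => a y x) ha (fun x y h => ha y x h.symm) hw c hc
  refine ⟨fun i => n (.inl i), fun j => n (.inr j), fun i => hn _, fun i j => ?_⟩
  have h2 := hp i j
  have h3 : (n (.inl i) : ℝ) * branchingD G i j = n (.inr j) * branchingK G j i := by
    rw [hl, hl, mul_assoc, mul_assoc]
    exact congrArg (l * ·) h2
  exact_mod_cast h3

end Hypergraph

/-! ### From reversibility to local convergence -/

namespace TypedHypergraph

variable {A : Type*} {B : Type*} {V : Type*} {W : Type*}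

theorem nonempty_edges_equiv (H : TypedHypergraph A B V) (x : H.vertexSet) (j : B) :
    Nonempty ({y // H.incidenceGraph.Adj (.inl x) y ∧ H.nodeType y = .inr j} ≃
      {e : H.edgeSet // x.1 ∈ e.1 ∧ H.etype e = j}) :=
  ⟨(Equiv.ofBijective (fun e => ⟨.inr e.1, e.2.1, congrArg Sum.inr e.2.2⟩)
    ⟨fun e e' h => Subtype.ext (Sum.inr.inj (congrArg Subtype.val h)), by
      rintro ⟨y | e, h, h'⟩
      · exact h.elim
      · exact ⟨⟨e, h, Sum.inr.inj h'⟩, rfl⟩⟩).symm⟩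

theorem nonempty_vertices_equiv (H : TypedHypergraph A B V) (e : H.edgeSet) (i : A) :
    Nonempty ({y // H.incidenceGraph.Adj (.inr e) y ∧ H.nodeType y = .inl i} ≃
      {x : H.vertexSet // x.1 ∈ e.1 ∧ H.vtype x = i}) :=
  ⟨(Equiv.ofBijective (fun e => ⟨.inl e.1, e.2.1, congrArg Sum.inl e.2.2⟩)
    ⟨fun e e' h => Subtype.ext (Sum.inl.inj (congrArg Subtype.val h)), by
      rintro ⟨y | e, h, h'⟩
      · exact ⟨⟨y, h, Sum.inl.inj h'⟩, rfl⟩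
      · exact h.elim⟩).symm⟩

theorem isEmpty_vertices_of_vertex (H : TypedHypergraph A B V) (x : H.vertexSet) (i : A) :
    IsEmpty {y // H.incidenceGraph.Adj (.inl x) y ∧ H.nodeType y = .inl i} :=
  ⟨by
    rintro ⟨y | e, h, h'⟩
    · exact h.elim
    · exact Sum.inr_ne_inl h'⟩

theorem isEmpty_edges_of_edge (H : TypedHypergraph A B V) (e : H.edgeSet) (j : B) :
    IsEmpty {y // H.incidenceGraph.Adj (.inr e) y ∧ H.nodeType y = .inr j} :=
  ⟨by
    rintro ⟨y | e, h, h'⟩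
    · exact Sum.inl_ne_inr h'
    · exact h.elim⟩

theorem nonempty_neighbors_equiv (T : TypedHypergraph A B V) (H : TypedHypergraph A B W)
    (hv : ∀ (x : T.vertexSet) (y : H.vertexSet), T.vtype x = H.vtype y → ∀ j,
      Nonempty ({e : T.edgeSet // x.1 ∈ e.1 ∧ T.etype e = j} ≃
        {e : H.edgeSet // y.1 ∈ e.1 ∧ H.etype e = j}))
    (he : ∀ (e : T.edgeSet) (f : H.edgeSet), T.etype e = H.etype f → ∀ i,
      Nonempty ({x : T.vertexSet // x.1 ∈ e.1 ∧ T.vtype x = i} ≃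
        {x : H.vertexSet // x.1 ∈ f.1 ∧ H.vtype x = i}))
    (a : T.vertexSet ⊕ T.edgeSet) (b : H.vertexSet ⊕ H.edgeSet) (hab : T.nodeType a = H.nodeType b)
    (c : A ⊕ B) :
    Nonempty ({x // T.incidenceGraph.Adj a x ∧ T.nodeType x = c} ≃
        {y // H.incidenceGraph.Adj b y ∧ H.nodeType y = c}) := by
  rcases a with x | e <;> rcases b with y | f
  · have h : T.vtype x = H.vtype y := Sum.inl.inj hab
    rcases c with i | j
    · have := T.isEmpty_vertices_of_vertex x i
      have := H.isEmpty_vertices_of_vertex y i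
      exact ⟨Equiv.equivOfIsEmpty _ _⟩
    · obtain ⟨e₁⟩ := T.nonempty_edges_equiv x j
      obtain ⟨e₂⟩ := H.nonempty_edges_equiv y j
      obtain ⟨e₃⟩ := hv x y h j
      exact ⟨e₁.trans (e₃.trans e₂.symm)⟩
  · exact absurd hab Sum.inl_ne_inr
  · exact absurd hab Sum.inr_ne_inl
  · have h : T.etype e = H.etype f := Sum.inr.inj hab
    rcases c with i | j
    · obtain ⟨e₁⟩ := T.nonempty_vertices_equiv e i
      obtain ⟨e₂⟩ := H.nonempty_vertices_equiv f i
      obtain ⟨e₃⟩ := he e f h i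
      exact ⟨e₁.trans (e₃.trans e₂.symm)⟩
    · have := T.isEmpty_edges_of_edge e j
      have := H.isEmpty_edges_of_edge f j
      exact ⟨Equiv.equivOfIsEmpty _ _⟩

end TypedHypergraph

namespace FiniteTypedHypergraph

variable {A : Type u} {B : Type v}

theorem finite_edgeSet (H : FiniteTypedHypergraph A B) : H.edgeSet.Finite :=
  H.finite_vertexSet.finite_subsets.subset fun _ he => H.subset_vertexSet_of_mem_edgeSet' he

theorem mem_verticesOfType (H : FiniteTypedHypergraph A B) (i : A) (x : H.vertexSet) :
    x ∈ H.verticesOfType i ↔ H.vtype x = i := by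
  simp [verticesOfType]

/-- Deterministic hypergraphs suffice: once `n ≥ t`, every vertex is correct and the probability is
exactly `1`. -/
theorem convergesLocally_pure {V : Type*} (H : ℕ → FiniteTypedHypergraph A B)
    (T : TypedHypergraph A B V)
    (h : ∀ (t n : ℕ), t ≤ n → ∀ (o : T.vertexSet) (x : (H n).vertexSet),
      T.vtype o = (H n).vtype x → ((H n).nbhd x.1 t).Isomorphic (T.nbhd o.1 t)) :
    ConvergesLocally (fun n => PMF.pure (H n)) T := by
  intro t i o ho
  refine tendsto_const_nhds.congr' ?_
  filter_upwards [eventually_ge_atTop t] with n hn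
  symm
  rw [PMF.toOuterMeasure_apply_eq_one_iff]
  intro z hz
  rw [jointLaw, PMF.pure_bind, PMF.mem_support_map_iff] at hz
  obtain ⟨x, hx, rfl⟩ := hz
  rw [PMF.mem_support_uniformOfFinset_iff, mem_verticesOfType] at hx
  exact h t n hn o x (ho.trans hx.symm)

end FiniteTypedHypergraph

theorem Hypergraph.IsRegularHypertree.exists_convergesLocally {V : Type u} {T : Hypergraph V}
    {k d : ℕ} (hT : T.IsRegularHypertree k d) (hk : 1 ≤ k) (G : Subgroup T.autGroup)
    [Fintype (VertexOrbit G)] [Fintype (EdgeOrbit G)]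
    (h : IsTimeReversible (projectedChain G k d)) :
    ∃ P : ℕ → PMF (FiniteTypedHypergraph (VertexOrbit G) (EdgeOrbit G)),
      FiniteTypedHypergraph.ConvergesLocally P (T.labelled G) := by
  obtain ⟨n, m, hn, hnm⟩ := hT.exists_nat_weights h
  choose H hgirth hD hK hne using fun r => exists_hypergraph_of_balanced (branchingD G)
    (branchingK G) n m hn hnm (hT.nontrivial_sigma_branchingK hk) r
  -- Girth beyond `4 * r + 4` serves all radii `t ≤ r` at once.
  refine ⟨_, FiniteTypedHypergraph.convergesLocally_pure (fun r => H (4 * r + 4)) _ ?_⟩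
  intro t r htr o x hox
  have hfin := (H (4 * r + 4)).finite_vertexSet.to_subtype
  have hfin' := (H (4 * r + 4)).finite_edgeSet.to_subtype
  refine TypedHypergraph.isomorphic_nbhd_of_noShortClosedWalk (T.labelled G) _ hT.isTree t
    (fun w l hl hlr => hgirth (4 * r + 4) w l hl (by omega)) ?_ (hne _) o x hox
  refine TypedHypergraph.nonempty_neighbors_equiv _ _ ?_ ?_
  · intro y z hyz j
    have : Finite {e : (T.labelled G).edgeSet // y.1 ∈ e.1 ∧ (T.labelled G).etype e = j} :=
      hT.finite_edges_of_type y j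
    rw [← Finite.card_eq, hD, ← hyz]
    rfl
  · intro y z hyz j
    have : Finite {x : (T.labelled G).vertexSet // x.1 ∈ y.1 ∧ (T.labelled G).vtype x = j} :=
      hT.finite_vertices_of_type y j
    rw [← Finite.card_eq, hK, ← hyz]
    rfl

/-! ### Reading the branching numbers off a neighbourhood -/

namespace Hypergraph

variable {V : Type u} {H : Hypergraph V}

theorem even_length_incidenceGraph {a b : H.vertexSet ⊕ H.edgeSet}
    (p : H.incidenceGraph.Walk a b) : Even p.length ↔ a.isLeft = b.isLeft := by
  induction p with
  | nil => simp
  | @cons a b c h p ih =>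
    rw [SimpleGraph.Walk.length_cons, Nat.even_add_one, ih]
    rcases a with a | a <;> rcases b with b | b
    · exact h.elim
    · cases c <;> simp
    · cases c <;> simp
    · exact h.elim

theorem even_dist_incidenceGraph (hH : H.incidenceGraph.Connected)
    (a b : H.vertexSet ⊕ H.edgeSet) :
    Even (H.incidenceGraph.dist a b) ↔ a.isLeft = b.isLeft := by
  obtain ⟨p, hp⟩ := hH.exists_walk_length_eq_dist a b
  rw [← hp, even_length_incidenceGraph]

/-- Walk `2 * t` steps from `o` away from `c`. By parity the endpoint is a vertex; it lies in the
ball about `o`, hence in that about `c`, and this leaves no room for a positive distance between `c`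
and `o`. -/
theorem eq_of_ball_subset (hH : H.incidenceGraph.IsTree)
    (h2 : ∀ a, ∃ x y, x ≠ y ∧ H.incidenceGraph.Adj a x ∧ H.incidenceGraph.Adj a y)
    (o c : H.vertexSet) (t : ℕ) (h : H.ball o.1 t ⊆ H.ball c.1 t) : c = o := by
  obtain ⟨y, hy, hoy⟩ := hH.exists_dist_eq_add h2 (.inl c) (.inl o) (2 * t)
  have he : Even (H.incidenceGraph.dist (.inl c) y) := by
    rw [hy]
    exact ((even_dist_incidenceGraph hH.1 (.inl c) (.inl o)).2 rfl).add (even_two_mul t)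
  rcases y with y | e
  · have h1 := dist_le_of_mem_ball hH.1 (h (mem_ball_of_dist_le hH.1 hoy))
    have h3 : H.incidenceGraph.dist (.inl c) (.inl o) = 0 := by omega
    exact Sum.inl.inj (hH.1.dist_eq_zero_iff.1 h3)
  · rw [even_dist_incidenceGraph hH.1] at he
    simp at he

theorem IsRegularHypertree.exists_ne_adj {k d : ℕ} (hT : H.IsRegularHypertree k d) (hk : 1 ≤ k)
    (hd : 1 ≤ d) (a : H.vertexSet ⊕ H.edgeSet) :
    ∃ x y, x ≠ y ∧ H.incidenceGraph.Adj a x ∧ H.incidenceGraph.Adj a y := by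
  rcases a with x | e
  · obtain ⟨e, e', hne, h, h'⟩ := hT.exists_ne_edges hd x
    exact ⟨.inr e, .inr e', fun h => hne (Sum.inr.inj h), h, h'⟩
  · obtain ⟨e, e', hne, h, h'⟩ := hT.exists_ne_vertices hk e
    exact ⟨.inl e, .inl e', fun h => hne (Sum.inl.inj h), h, h'⟩

end Hypergraph

namespace TypedHypergraph

open Hypergraph

variable {A : Type*} {B : Type*} {V : Type*} {W : Type*}

/-- Around the vertex `x` the hypergraph has the branching numbers `D` and `K`. -/
def HasBranchingAt (H : TypedHypergraph A B V) (D : A → B → ℕ) (K : B → A → ℕ)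
    (x : H.vertexSet) : Prop :=
  (∀ j, Nat.card {e : H.edgeSet // x.1 ∈ e.1 ∧ H.etype e = j} = D (H.vtype x) j) ∧
  ∀ e : H.edgeSet, x.1 ∈ e.1 → ∀ i,
    Nat.card {y : H.vertexSet // y.1 ∈ e.1 ∧ H.vtype y = i} = K (H.etype e) i

/-- Hyperedges at a vertex within distance 1 of the centre lie inside the 2-neighbourhood, so the
isomorphism sees them whole. The isomorphism is not assumed to preserve the root; this has to be
proved. -/
theorem hasBranchingAt_of_isomorphic_nbhd (T : TypedHypergraph A B V) (H : TypedHypergraph A B W)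
    (hT : T.incidenceGraph.IsTree)
    (h2 : ∀ a, ∃ x y, x ≠ y ∧ T.incidenceGraph.Adj a x ∧ T.incidenceGraph.Adj a y)
    (D : A → B → ℕ) (K : B → A → ℕ) (hDK : ∀ y, T.HasBranchingAt D K y)
    (x : H.vertexSet) (o : T.vertexSet) (h : (H.nbhd x.1 2).Isomorphic (T.nbhd o.1 2))
    (u : H.vertexSet) (hu : u.1 ∈ H.ball x.1 1) : H.HasBranchingAt D K u := by
  obtain ⟨f, g, hfg, hf, hg⟩ := h
  let x' : (H.nbhd x.1 2).vertexSet := ⟨x.1, x.2, self_mem_ball x.2 2⟩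
  let c : T.vertexSet := ⟨(f x').1, (f x').2.1⟩
  have hmaps : ∀ s, s ≤ 2 → ∀ y : (H.nbhd x.1 2).vertexSet, y.1 ∈ H.ball x.1 s →
      (f y).1 ∈ T.ball c.1 s := by
    intro s
    induction s with
    | zero =>
      intro _ y hy
      obtain rfl : y = x' := Subtype.ext (mem_ball_zero hy)
      exact self_mem_ball c.2 0
    | succ s ih =>
      intro hs y hy
      rcases mem_ball_succ hy with h | ⟨z, hz, e, he, hze, hye⟩
      · obtain rfl : y = x' := Subtype.ext h
        exact self_mem_ball c.2 _
      · have hsub : e ⊆ H.ball x.1 2 := fun v hv =>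
          ball_mono _ hs (mem_ball_succ_of_adj hz ⟨e, he, hze, hv⟩)
        let e' : (H.nbhd x.1 2).edgeSet := ⟨e, he, hsub⟩
        let z' : (H.nbhd x.1 2).vertexSet := ⟨z, hz.1, hsub hze⟩
        exact mem_ball_succ_of_adj (ih (by omega) z' hz)
          ⟨(g e').1, (g e').2.1, (hfg z' e').2 hze, (hfg y e').2 hye⟩
  -- Distances from `x` do not grow under `f`, and `f` is onto the ball about `o`; that ball
  -- therefore lies in the ball of the same radius about `c`.
  have hco : c = o := by
    refine eq_of_ball_subset hT h2 o c 2 fun y hy => ?_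
    obtain ⟨y', hy'⟩ := f.surjective ⟨y, hy.1, hy⟩
    have := hmaps 2 le_rfl y' y'.2.2
    rw [hy'] at this
    exact this
  let u' : (H.nbhd x.1 2).vertexSet := ⟨u.1, u.2, ball_mono _ one_le_two hu⟩
  have hfu : (f u').1 ∈ T.ball o.1 1 := by
    have := hmaps 1 one_le_two u' hu
    rwa [hco] at this
  have hsub : ∀ e : H.edgeSet, u.1 ∈ e.1 → e.1 ⊆ H.ball x.1 2 := fun e he v hv =>
    mem_ball_succ_of_adj hu ⟨e.1, e.2, he, hv⟩
  have hsub' : ∀ e : T.edgeSet, (f u').1 ∈ e.1 → e.1 ⊆ T.ball o.1 2 := fun e he v hv =>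
    mem_ball_succ_of_adj hfu ⟨e.1, e.2, he, hv⟩
  let fu : T.vertexSet := ⟨(f u').1, (f u').2.1⟩
  have hfut : T.vtype fu = H.vtype u := hf u'
  constructor
  · intro j
    rw [← hfut, ← (hDK fu).1 j]
    let φ : {e : H.edgeSet // u.1 ∈ e.1 ∧ H.etype e = j} →
        {e : T.edgeSet // fu.1 ∈ e.1 ∧ T.etype e = j} := fun e =>
      ⟨⟨(g ⟨e.1.1, e.1.2, hsub e.1 e.2.1⟩).1, (g ⟨e.1.1, e.1.2, hsub e.1 e.2.1⟩).2.1⟩,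
        (hfg u' ⟨e.1.1, e.1.2, hsub e.1 e.2.1⟩).2 e.2.1,
        (hg ⟨e.1.1, e.1.2, hsub e.1 e.2.1⟩).trans e.2.2⟩
    refine Nat.card_eq_of_bijective φ ⟨?_, ?_⟩
    · intro e e' hee
      have h1 := congrArg (fun z => z.1.1) hee
      have h2 := congrArg Subtype.val (g.injective (Subtype.ext h1))
      exact Subtype.ext (Subtype.ext h2)
    · rintro ⟨e, he, hej⟩
      obtain ⟨e', hee⟩ := g.surjective ⟨e.1, e.2, hsub' e he⟩
      have hue : u.1 ∈ e'.1 := (hfg u' e').1 (by rw [hee]; exact he)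
      refine ⟨⟨⟨e'.1, e'.2.1⟩, hue, ?_⟩, ?_⟩
      · rw [← hej]
        have := hg e'
        rw [hee] at this
        exact this.symm
      · have h1 := congrArg Subtype.val hee
        exact Subtype.ext (Subtype.ext h1)
  · intro e hue i
    let e' : (H.nbhd x.1 2).edgeSet := ⟨e.1, e.2, hsub e hue⟩
    let ge : T.edgeSet := ⟨(g e').1, (g e').2.1⟩
    have hget : T.etype ge = H.etype e := hg e'
    have hfe : fu.1 ∈ ge.1 := (hfg u' e').2 hue
    rw [← hget, ← (hDK fu).2 ge hfe i]
    let φ : {y : H.vertexSet // y.1 ∈ e.1 ∧ H.vtype y = i} →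
        {y : T.vertexSet // y.1 ∈ ge.1 ∧ T.vtype y = i} := fun y =>
      ⟨⟨(f ⟨y.1.1, y.1.2, e'.2.2 y.2.1⟩).1, (f ⟨y.1.1, y.1.2, e'.2.2 y.2.1⟩).2.1⟩,
        (hfg ⟨y.1.1, y.1.2, e'.2.2 y.2.1⟩ e').2 y.2.1,
        (hf ⟨y.1.1, y.1.2, e'.2.2 y.2.1⟩).trans y.2.2⟩
    refine Nat.card_eq_of_bijective φ ⟨?_, ?_⟩
    · intro y y' hyy
      have h1 := congrArg (fun z => z.1.1) hyy
      have h2 := congrArg Subtype.val (f.injective (Subtype.ext h1))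
      exact Subtype.ext (Subtype.ext h2)
    · rintro ⟨y, hy, hyi⟩
      obtain ⟨y', hyy⟩ := f.surjective ⟨y.1, y.2, (g e').2.2 hy⟩
      have hye : y'.1 ∈ e.1 := (hfg y' e').1 (by rw [hyy]; exact hy)
      refine ⟨⟨⟨y'.1, y'.2.1⟩, hye, ?_⟩, ?_⟩
      · rw [← hyi]
        have := hf y'
        rw [hyy] at this
        exact this.symm
      · have h1 := congrArg Subtype.val hyy
        exact Subtype.ext (Subtype.ext h1)

end TypedHypergraph

/-! ### Double counting in finite hypergraphs -/

namespace FiniteTypedHypergraph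

open Classical Hypergraph

variable {A : Type u} {B : Type v}

/-- Double counting of incidences around the vertices with correct branching. -/
theorem exists_edge_counts (H : FiniteTypedHypergraph A B) (D : A → B → ℕ) (K : B → A → ℕ)
    (good : H.vertexSet → Prop)
    (hgood : ∀ x, good x → ∀ u : H.vertexSet, u.1 ∈ H.ball x.1 1 → H.HasBranchingAt D K u) :
    ∃ m : B → ℕ, ∀ i j,
      ((H.verticesOfType i).filter good).card * D i j ≤ m j * K j i ∧
        m j * K j i ≤ (H.verticesOfType i).card * D i j := by
  have := H.finite_vertexSet.to_subtype
  have := H.finite_edgeSet.to_subtype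
  have := Fintype.ofFinite H.vertexSet
  have := Fintype.ofFinite H.edgeSet
  -- Only hyperedges meeting a good vertex are counted. All their vertices are within distance 1 of
  -- a good one, so both ends of each counted incidence have the correct branching.
  let M : B → Finset H.edgeSet := fun j =>
    {e | H.etype e = j ∧ ∃ x : H.vertexSet, x.1 ∈ e.1 ∧ good x}
  have hM : ∀ j e, e ∈ M j ↔ H.etype e = j ∧ ∃ x : H.vertexSet, x.1 ∈ e.1 ∧ good x := fun j e => by
    simp [M]
  have hb : ∀ x, good x → H.HasBranchingAt D K x := fun x hx =>
    hgood x hx x (self_mem_ball x.2 1)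
  have hD : ∀ i j (x : H.vertexSet), H.vtype x = i → H.HasBranchingAt D K x →
      (Finset.univ.filter fun e : H.edgeSet => x.1 ∈ e.1 ∧ H.etype e = j).card = D i j := by
    rintro _ j x rfl hx
    rw [← hx.1 j, Nat.card_eq_fintype_card, Fintype.card_subtype]
  have hK : ∀ i j (e : H.edgeSet), e ∈ M j →
      (Finset.univ.filter fun x : H.vertexSet => x.1 ∈ e.1 ∧ H.vtype x = i).card = K j i := by
    intro i j e he
    obtain ⟨rfl, x, hxe, hx⟩ := (hM _ _).1 he
    rw [← (hb x hx).2 e hxe i, Nat.card_eq_fintype_card, Fintype.card_subtype]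
  refine ⟨fun j => (M j).card, fun i j => ⟨?_, ?_⟩⟩
  · refine Finset.card_mul_le_card_mul (fun (x : H.vertexSet) (e : H.edgeSet) => x.1 ∈ e.1) ?_ ?_
    · intro x hx
      rw [Finset.mem_filter, mem_verticesOfType] at hx
      rw [← hD i j x hx.1 (hb x hx.2)]
      refine Finset.card_le_card fun e he => ?_
      simp only [Finset.mem_filter, Finset.mem_univ, true_and] at he
      rw [Finset.mem_bipartiteAbove, hM]
      exact ⟨⟨he.2, x, he.1, hx.2⟩, he.1⟩
    · intro e he
      rw [← hK i j e he]
      refine Finset.card_le_card fun x hx => ?_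
      rw [Finset.mem_bipartiteBelow, Finset.mem_filter, mem_verticesOfType] at hx
      simp only [Finset.mem_filter, Finset.mem_univ, true_and]
      exact ⟨hx.2, hx.1.1⟩
  · refine Finset.card_mul_le_card_mul (fun (e : H.edgeSet) (x : H.vertexSet) => x.1 ∈ e.1) ?_ ?_
    · intro e he
      rw [← hK i j e he]
      refine Finset.card_le_card fun x hx => ?_
      simp only [Finset.mem_filter, Finset.mem_univ, true_and] at hx
      rw [Finset.mem_bipartiteAbove, mem_verticesOfType]
      exact ⟨hx.2, hx.1⟩
    · intro x hx
      rw [mem_verticesOfType] at hx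
      by_cases hne : ∃ e ∈ M j, x.1 ∈ e.1
      · obtain ⟨e, he, hxe⟩ := hne
        obtain ⟨-, y, hye, hy⟩ := (hM _ _).1 he
        have hxy : x.1 ∈ H.ball y.1 1 :=
          mem_ball_succ_of_adj (self_mem_ball y.2 0) ⟨e.1, e.2, hye, hxe⟩
        rw [← hD i j x hx (hgood y hy x hxy)]
        refine Finset.card_le_card fun e' he' => ?_
        rw [Finset.mem_bipartiteBelow, hM] at he'
        simp only [Finset.mem_filter, Finset.mem_univ, true_and]
        exact ⟨he'.2, he'.1.1⟩
      · rw [Finset.card_eq_zero.2]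
        · exact Nat.zero_le _
        · refine Finset.eq_empty_of_forall_notMem fun e he => hne ?_
          rw [Finset.mem_bipartiteBelow] at he
          exact ⟨e, he⟩

open scoped ENNReal

/-- Local convergence produces a deterministic hypergraph in which almost all vertices of each
type have the right neighbourhood. -/
theorem ConvergesLocally.exists_good [Fintype A] [Nonempty A] {V : Type*}
    {P : ℕ → PMF (FiniteTypedHypergraph A B)} {T : TypedHypergraph A B V}
    (hP : ConvergesLocally P T) (hT : Function.Surjective T.vtype) (t : ℕ) {ε : ℝ} (hε : 0 < ε) :
    ∃ H : FiniteTypedHypergraph A B, ∀ i,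
      (1 - ε) * (H.verticesOfType i).card ≤ ((H.verticesOfType i).filter
        fun x => ∃ o : T.vertexSet, (H.nbhd x.1 t).Isomorphic (T.nbhd o.1 t)).card := by
  choose o ho using hT
  let q : A → FiniteTypedHypergraph A B → ℝ≥0∞ := fun i H =>
    (PMF.uniformOfFinset (H.verticesOfType i) (H.verticesOfType_nonempty i)).toOuterMeasure
      {x | (H.nbhd x.1 t).Isomorphic (T.nbhd (o i).1 t)}
  have hq : ∀ n i, (jointLaw (P n) i).toOuterMeasure
      {z | (z.1.nbhd z.2 t).Isomorphic (T.nbhd (o i).1 t)} = ∑' H, P n H * q i H := by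
    intro n i
    rw [jointLaw, PMF.toOuterMeasure_bind_apply]
    refine tsum_congr fun H => ?_
    rw [PMF.toOuterMeasure_map_apply]
    rfl
  have hq1 : ∀ i H, q i H ≤ 1 := by
    intro i H
    dsimp only [q]
    rw [PMF.toOuterMeasure_apply, ← PMF.tsum_coe (PMF.uniformOfFinset (H.verticesOfType i)
      (H.verticesOfType_nonempty i))]
    exact ENNReal.tsum_le_tsum fun x => Set.indicator_le_self _ _ x
  -- A single `H` must work for all types. If each `H` failed for some type, the sum of the
  -- probabilities over all types would stay at most `card A - ε` on average, but it tends to `card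
  -- A`.
  obtain ⟨H, hH⟩ : ∃ H, ∀ i, 1 < q i H + ENNReal.ofReal ε := by
    by_contra! hcon
    have hsum : ∀ H, ∑ i, q i H + ENNReal.ofReal ε ≤ Fintype.card A := by
      intro H
      obtain ⟨i, hi⟩ := hcon H
      rw [← Finset.add_sum_erase _ _ (Finset.mem_univ i), add_right_comm]
      calc _ ≤ 1 + ∑ i' ∈ Finset.univ.erase i, (1 : ℝ≥0∞) :=
            add_le_add hi (Finset.sum_le_sum fun i' _ => hq1 i' H)
        _ = Fintype.card A := by
          rw [Finset.add_sum_erase _ (fun _ => (1 : ℝ≥0∞)) (Finset.mem_univ i)]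
          simp
    have hle : ∀ n, ∑ i, ∑' H, P n H * q i H + ENNReal.ofReal ε ≤ Fintype.card A := by
      intro n
      calc ∑ i, ∑' H, P n H * q i H + ENNReal.ofReal ε
          = ∑' H, P n H * (∑ i, q i H + ENNReal.ofReal ε) := by
            simp_rw [mul_add, Finset.mul_sum]
            rw [ENNReal.tsum_add, ENNReal.tsum_mul_right, PMF.tsum_coe, one_mul,
              Summable.tsum_finsetSum fun _ _ => ENNReal.summable]
        _ ≤ ∑' H, P n H * Fintype.card A := ENNReal.tsum_le_tsum fun H => by gcongr; exact hsum H
        _ = Fintype.card A := by rw [ENNReal.tsum_mul_right, PMF.tsum_coe, one_mul]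
    have hlim : Tendsto (fun n => ∑ i, ∑' H, P n H * q i H + ENNReal.ofReal ε) atTop
        (𝓝 (∑ _i : A, 1 + ENNReal.ofReal ε)) := by
      refine Tendsto.add (tendsto_finsetSum _ fun i _ => ?_) tendsto_const_nhds
      simpa only [hq] using hP t i (o i) (ho i)
    have h1 := le_of_tendsto' hlim hle
    have h2 : (Fintype.card A : ℝ≥0∞) + ENNReal.ofReal ε ≤ Fintype.card A := by simpa using h1
    have h3 : (Fintype.card A : ℝ≥0∞) < Fintype.card A + ENNReal.ofReal ε :=
      ENNReal.lt_add_right (ENNReal.natCast_ne_top _) (by simpa using hε)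
    exact absurd h2 (not_le.2 h3)
  refine ⟨H, fun i => ?_⟩
  have h1 := hH i
  have hpos : (0 : ℝ) < (H.verticesOfType i).card := by
    exact_mod_cast (H.verticesOfType_nonempty i).card_pos
  set R := (H.verticesOfType i).filter
    (fun x => (H.nbhd x.1 t).Isomorphic (T.nbhd (o i).1 t)) with hR
  have hqR : q i H = ENNReal.ofReal (R.card / (H.verticesOfType i).card) := by
    rw [ENNReal.ofReal_div_of_pos hpos, ENNReal.ofReal_natCast, ENNReal.ofReal_natCast]
    exact PMF.toOuterMeasure_uniformOfFinset_apply _ _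
  rw [hqR, ← ENNReal.ofReal_add (by positivity) hε.le, ← ENNReal.ofReal_one,
    ENNReal.ofReal_lt_ofReal_iff_of_nonneg zero_le_one] at h1
  have h2 : (1 - ε) * (H.verticesOfType i).card ≤ R.card := by
    rw [← le_div_iff₀ hpos]
    linarith
  refine h2.trans ?_
  have : R.card ≤ ((H.verticesOfType i).filter
        fun x => ∃ o : T.vertexSet, (H.nbhd x.1 t).Isomorphic (T.nbhd o.1 t)).card :=
    Finset.card_le_card (Finset.monotone_filter_right _ fun x _ hx => ⟨o i, hx⟩)
  exact_mod_cast this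

end FiniteTypedHypergraph

/-! ### Compactness -/

/-- Approximate solutions of the balance equations give an exact one, by compactness. -/
theorem exists_balanced_of_approx {A B : Type*} [Fintype A] [Fintype B] [Nonempty A]
    (D : A → B → ℕ) (K : B → A → ℕ) (k d : ℕ)
    (h : ∀ ε : ℝ, 0 < ε → ∃ (n : A → ℕ) (m : B → ℕ), (∀ i, 0 < n i) ∧
      ∀ i j, |(n i : ℝ) * D i j - m j * K j i| ≤ ε * (n i * D i j)) :
    ∃ p : A ⊕ B → ℝ, (∀ x, 0 ≤ p x) ∧ ∑ x, p x = 1 ∧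
      ∀ i j, p (.inl i) / (d + 1) * D i j = p (.inr j) / (k + 1) * K j i := by
  -- The total defect in the balance equations. It attains its minimum on the simplex, and
  -- normalised approximate solutions make that minimum arbitrarily small.
  let F : (A ⊕ B → ℝ) → ℝ := fun p =>
    ∑ i, ∑ j, |p (.inl i) / (d + 1) * D i j - p (.inr j) / (k + 1) * K j i|
  have hF : Continuous F := by fun_prop
  classical
  obtain ⟨p, hp, hmin⟩ := (isCompact_stdSimplex ℝ (A ⊕ B)).exists_isMinOn
    ⟨_, single_mem_stdSimplex ℝ (Sum.inl (Classical.arbitrary A))⟩ hF.continuousOn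
  refine ⟨p, hp.1, hp.2, ?_⟩
  have hF0 : F p ≤ 0 := by
    have hbound : ∀ ε : ℝ, 0 < ε → F p ≤ ε * ∑ i, ∑ j, (D i j : ℝ) := by
      intro ε hε
      obtain ⟨n, m, hn, hnm⟩ := h ε hε
      -- The factors `d + 1` and `k + 1` undo the denominators of the chain; they also give `n i ≤ ∑
      -- x, w x`, so the relative error survives normalisation.
      let w : A ⊕ B → ℝ := Sum.elim (fun i => (d + 1) * n i) (fun j => (k + 1) * m j)
      have hw : ∀ x, 0 ≤ w x := by
        rintro (i | j) <;> simp only [w, Sum.elim_inl, Sum.elim_inr] <;> positivity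
      have hle : ∀ i, (n i : ℝ) ≤ ∑ x, w x := by
        intro i
        refine le_trans ?_ (Finset.single_le_sum (fun x _ => hw x) (Finset.mem_univ (Sum.inl i)))
        simp only [w, Sum.elim_inl]
        have h1 : (0 : ℝ) ≤ n i := by positivity
        have h2 : (0 : ℝ) ≤ d := by positivity
        nlinarith
      have hZ : 0 < ∑ x, w x :=
        lt_of_lt_of_le (by exact_mod_cast hn (Classical.arbitrary A)) (hle (Classical.arbitrary A))
      have hmem : (fun x => w x / ∑ x, w x) ∈ stdSimplex ℝ (A ⊕ B) :=
        ⟨fun x => div_nonneg (hw x) hZ.le, by rw [← Finset.sum_div, div_self hZ.ne']⟩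
      refine (hmin hmem).trans ?_
      rw [Finset.mul_sum]
      refine Finset.sum_le_sum fun i _ => ?_
      rw [Finset.mul_sum]
      refine Finset.sum_le_sum fun j _ => ?_
      have h1 : w (.inl i) / (∑ x, w x) / (d + 1) * D i j - w (.inr j) / (∑ x, w x) / (k + 1) * K j i
          = (n i * D i j - m j * K j i) / ∑ x, w x := by
        simp only [w, Sum.elim_inl, Sum.elim_inr]
        field_simp
      rw [h1, abs_div, abs_of_pos hZ, div_le_iff₀ hZ]
      refine (hnm i j).trans ?_
      have h2 : (n i : ℝ) * D i j ≤ (∑ x, w x) * D i j :=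
        mul_le_mul_of_nonneg_right (hle i) (by positivity)
      calc ε * (n i * D i j) ≤ ε * ((∑ x, w x) * D i j) := mul_le_mul_of_nonneg_left h2 hε.le
        _ = ε * D i j * ∑ x, w x := by ring
    have hlim : Tendsto (fun ε : ℝ => ε * ∑ i, ∑ j, (D i j : ℝ)) (𝓝[>] 0) (𝓝 0) := by
      have : Tendsto (fun ε : ℝ => ε * ∑ i, ∑ j, (D i j : ℝ)) (𝓝 0)
          (𝓝 (0 * ∑ i, ∑ j, (D i j : ℝ))) := tendsto_id.mul_const _
      rw [zero_mul] at this
      exact this.mono_left nhdsWithin_le_nhds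
    refine ge_of_tendsto hlim ?_
    filter_upwards [self_mem_nhdsWithin] with ε hε using hbound ε hε
  intro i j
  have h1 : |p (.inl i) / (d + 1) * D i j - p (.inr j) / (k + 1) * K j i| ≤ F p :=
    (Finset.single_le_sum (f := fun j => |p (.inl i) / (d + 1) * D i j - p (.inr j) / (k + 1) * K j i|)
      (fun _ _ => abs_nonneg _) (Finset.mem_univ j)).trans
    (Finset.single_le_sum
      (f := fun i => ∑ j, |p (.inl i) / (d + 1) * D i j - p (.inr j) / (k + 1) * K j i|)
      (fun _ _ => Finset.sum_nonneg fun _ _ => abs_nonneg _) (Finset.mem_univ i))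
  exact sub_eq_zero.1 (abs_nonpos_iff.1 (h1.trans hF0))

/-! ### Necessity of reversibility, and the extremal case -/

namespace Hypergraph

open Classical

variable {V : Type u} {T : Hypergraph V} {k d : ℕ} {G : Subgroup T.autGroup}

/-- With `N` vertices of type `i`, the quantity `m j * K j i` lies between `(1 - ε) * N * D i j` and
`N * D i j`; radius 2 is what the double count requires. -/
theorem IsRegularHypertree.isTimeReversible [Fintype (VertexOrbit G)] [Fintype (EdgeOrbit G)]
    (hT : T.IsRegularHypertree k d) (hk : 1 ≤ k) (hd : 1 ≤ d)
    {P : ℕ → PMF (FiniteTypedHypergraph (VertexOrbit G) (EdgeOrbit G))}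
    (hP : FiniteTypedHypergraph.ConvergesLocally P (T.labelled G)) :
    IsTimeReversible (projectedChain G k d) := by
  have hne : Nonempty (VertexOrbit G) := (hT.vertexSet_nonempty hk).map (vertexOrbit G)
  obtain ⟨p, h0, h1, hp⟩ := exists_balanced_of_approx (branchingD G) (branchingK G) k d (by
    intro ε hε
    obtain ⟨H, hH⟩ := hP.exists_good (vertexOrbit_surjective G) 2 hε
    obtain ⟨m, hm⟩ := H.exists_edge_counts (branchingD G) (branchingK G)
      (fun x => ∃ o : (T.labelled G).vertexSet,
        (H.nbhd x.1 2).Isomorphic ((T.labelled G).nbhd o.1 2)) (by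
        rintro x ⟨o, ho⟩ u hu
        exact TypedHypergraph.hasBranchingAt_of_isomorphic_nbhd (T.labelled G) _ hT.isTree
          (hT.exists_ne_adj hk hd) _ _
          (fun y => ⟨fun j => (branchingD_apply G y j).symm,
            fun e _ i => (branchingK_apply G e i).symm⟩) x o ho u hu)
    refine ⟨fun i => (H.verticesOfType i).card, m,
      fun i => (H.verticesOfType_nonempty i).card_pos, fun i j => ?_⟩
    obtain ⟨h1, h2⟩ := hm i j
    have h3 := hH i
    have h1' : ((((H.verticesOfType i).filter fun x => ∃ o : (T.labelled G).vertexSet,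
        (H.nbhd x.1 2).Isomorphic ((T.labelled G).nbhd o.1 2)).card : ℕ) : ℝ) * branchingD G i j ≤
          m j * branchingK G j i := by exact_mod_cast h1
    have h2' : (m j : ℝ) * branchingK G j i ≤ (H.verticesOfType i).card * branchingD G i j := by
      exact_mod_cast h2
    have h4 := mul_le_mul_of_nonneg_right h3 (Nat.cast_nonneg (α := ℝ) (branchingD G i j))
    rw [abs_le]
    constructor
    · nlinarith [mul_nonneg hε.le (mul_nonneg (Nat.cast_nonneg (α := ℝ) (H.verticesOfType i).card)
        (Nat.cast_nonneg (α := ℝ) (branchingD G i j)))]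
    · nlinarith)
  exact ⟨p, h0, h1, (detailedBalance_iff p).2 hp⟩

theorem IsExtremalSymmetry.not_isTimeReversible [Fintype (VertexOrbit G)]
    [Fintype (EdgeOrbit G)] (hG : IsExtremalSymmetry G k d) (hk : 2 ≤ k) (hd : 1 ≤ d) :
    ¬ IsTimeReversible (projectedChain G k d) := by
  rintro ⟨p, -, h1, hp⟩
  rw [detailedBalance_iff] at hp
  obtain ⟨a, b, hD, hK⟩ := hG
  set x : Fin 2 → ℝ := fun i => p (.inl (a.symm i)) / (d + 1) with hx
  set y : Fin 2 → ℝ := fun j => p (.inr (b.symm j)) / (k + 1) with hy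
  have h00 : x 0 = y 0 * k := by simpa [hD, hK] using hp (a.symm 0) (b.symm 0)
  have h01 : x 0 * d = y 1 := by simpa [hD, hK] using hp (a.symm 0) (b.symm 1)
  have h10 : x 1 * d = y 0 := by simpa [hD, hK] using hp (a.symm 1) (b.symm 0)
  have h11 : x 1 = y 1 * k := by simpa [hD, hK] using hp (a.symm 1) (b.symm 1)
  have hk' : (2 : ℝ) ≤ k := by exact_mod_cast hk
  have hd' : (1 : ℝ) ≤ d := by exact_mod_cast hd
  have hkd : (2 : ℝ) ≤ k * d := by nlinarith
  -- Going once around the cycle of the four types gives `y 0 = (k * d) ^ 2 * y 0`, and `k * d ≥ 2`.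
  have hy0 : y 0 = 0 := by
    have : y 0 * ((k * d) ^ 2 - 1) = 0 := by
      have : y 0 = y 0 * k * d * k * d := by rw [← h00, h01, ← h11, h10]
      linear_combination -this
    rcases mul_eq_zero.1 this with h | h
    · exact h
    · nlinarith
  have hx0 : x 0 = 0 := by rw [h00, hy0, zero_mul]
  have hy1 : y 1 = 0 := by rw [← h01, hx0, zero_mul]
  have hx1 : x 1 = 0 := by rw [h11, hy1, zero_mul]
  have hxz : ∀ i, x i = 0 := by intro i; fin_cases i <;> assumption
  have hyz : ∀ i, y i = 0 := by intro i; fin_cases i <;> assumption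
  have hd0 : (d : ℝ) + 1 ≠ 0 := by positivity
  have hk0 : (k : ℝ) + 1 ≠ 0 := by positivity
  have hp0 : ∀ c, p c = 0 := by
    rintro (i | j)
    · have := hxz (a i)
      simpa [hx, hd0] using this
    · have := hyz (b j)
      simpa [hy, hk0] using this
  simp [hp0] at h1

end Hypergraph

theorem theorem3 {V : Type*} (k d : ℕ) (hk : 1 ≤ k) (hd : 1 ≤ d)
    (T : Hypergraph V) (hT : T.IsRegularHypertree k d) (G : Subgroup T.autGroup)
    [Fintype (Hypergraph.VertexOrbit G)] [Fintype (Hypergraph.EdgeOrbit G)] :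
    ((∃ P : ℕ → PMF (FiniteTypedHypergraph (Hypergraph.VertexOrbit G) (Hypergraph.EdgeOrbit G)),
        FiniteTypedHypergraph.ConvergesLocally P (T.labelled G)) ↔
      IsTimeReversible (Hypergraph.projectedChain G k d)) ∧
    (2 ≤ k → Hypergraph.IsExtremalSymmetry G k d →
      ¬ ∃ P : ℕ → PMF (FiniteTypedHypergraph (Hypergraph.VertexOrbit G) (Hypergraph.EdgeOrbit G)),
        FiniteTypedHypergraph.ConvergesLocally P (T.labelled G)) :=
  ⟨⟨fun ⟨_, hP⟩ => hT.isTimeReversible hk hd hP, hT.exists_convergesLocally hk G⟩,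
    fun hk2 hG ⟨_, hP⟩ => hG.not_isTimeReversible hk2 hd (hT.isTimeReversible hk hd hP)⟩
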